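/- Let $\mathbb K$ be a field of characteristic $0$ and let $V=\bigoplus_{i\in\mathbb Z}V^i$ be a graded vector space over $\mathbb K$. Let $S^c(V)=\bigoplus_{n\ge 0}V^{\odot n}$ be its symmetric coalgebra, where $V^{\odot n}$ is the $n$-th graded symmetric power and the coproduct $\Delta$ is the sum over unshuffles with Koszul signs. An $L_\infty[1]$-algebra structure on $V$ is a coderivation $Q$ of $S^c(V)$ of degree $+1$ with $Q(1)=0$ and $QQ=0$. Its brackets $q_k\colon V^{\odot k}\to V$, $k\ge 1$, are the components of $Q$ followed by the projection $S^c(V)\to V$; they determine $Q$, and one writes $(V,q_1,q_2,\ldots)$. The algebra is minimal if $q_1=0$; in that case $(V,0,q_2,0,0,\ldots)$ is again an $L_\infty[1]$-algebra. An $L_\infty$-morphism $(V,Q)\dashrightarrow(W,R)$ is a morphism of graded coalgebras $f\colon S^c(V)\to S^c(W)$, compatible with counits and with $f(1)=1$, such that $fQ=Rf$; it is an $L_\infty$-isomorphism if $f$ is bijective. The Chevalley–Eilenberg complex $CE(V,V)$ of $(V,Q)$ is the graded space of coderivations of $S^c(V)$, with differential $d\alpha=Q\alpha-(-1)^{\deg\alpha}\alpha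 Q$ and filtration $F^p=\{\alpha\mid \alpha(V^{\odot i})=0 \text{ for all } i<p\}$. Let $(E(V,V)^{p,q}_r,d_r)$ be the spectral sequence of this filtered complex: with \[Z^{p,q}_r=\{x\in F^pCE^{p+q}\mid dx\in F^{p+r}CE^{p+q+1}\}\] one has \[E^{p,q}_r=\frac{Z^{p,q}_r}{Z^{p+1,q-1}_{r-1}+dZ^{p-r+1,q+r-2}_{r-1}},\] and $d_r\colon E^{p,q}_r\to E^{p+r,q-r+1}_r$ is induced by $d$. It degenerates at $E_2$ if $d_r=0$ for every $r\ge 2$. For a minimal algebra the Euler class $e\in E(V,V)^{1,-1}_2$ is the class of the coderivation of $S^c(V)$ whose composition with the projection $S^c(V)\to V$ is $v\mapsto(\deg v+1)\,v$ on homogeneous $v\in V$ and zero on $V^{\odot n}$ for $n\neq 1$. Theorem. For a minimal $L_\infty[1]$-algebra $(V,0,q_2,q_3,\ldots)$ with Euler class $e\in E(V,V)^{1,-1}_2$ the following conditions are equivalent: 1. there exists an $L_\infty$-isomorphism $f\colon(V,0,q_2,0,0,\ldots)\dashrightarrow(V,0,q_2,q_3,\ldots)$; 2. the spectral sequence $E(V,V)^{p,q}_r$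 degenerates at $E_2$; 3. $d_r(e)=0\in E(V,V)^{r+1,-r}_r$ for every $r\ge 2$, where $e$ is regarded recursively as an element of $E(V,V)^{1,-1}_r$: if $d_r(e)=0$, then $e$ defines a class in $E^{1,-1}_{r+1}\cong\ker d_r/\operatorname{im}d_r$. -/

import Mathlib

namespace LInfinity

open scoped TensorProduct DirectSum

noncomputable section

/-- The sign `(-1)^n`, as an element of the ground field. -/
def sgn (K : Type*) [Field K] (n : ℤ) : K := ((n.negOnePow : ℤ) : K)

section Sign

variable {K : Type*} [Field K]

@[simp]
theorem sgn_zero : sgn K 0 = 1 := by simp [sgn]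

theorem sgn_one : sgn K 1 = -1 := by simp [sgn]

theorem sgn_add (m n : ℤ) : sgn K (m + n) = sgn K m * sgn K n := by
  simp [sgn, Int.negOnePow_add]

theorem sgn_mul_self (m : ℤ) : sgn K m * sgn K m = 1 := by
  rw [← sgn_add, ← two_mul]; simp [sgn, Int.negOnePow_two_mul]

end Sign

variable {K V : Type*} [Field K] [AddCommGroup V] [Module K V]

/-- The relations `x ⊗ y = (-1)^(deg x * deg y) y ⊗ x` of graded commutativity. -/
inductive SymRel (𝒱 : ℤ → Submodule K V) : TensorAlgebra K V → TensorAlgebra K V → Prop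
  | comm (i j : ℤ) (x y : V) (hx : x ∈ 𝒱 i) (hy : y ∈ 𝒱 j) :
      SymRel 𝒱 (TensorAlgebra.ι K x * TensorAlgebra.ι K y)
        (sgn K (i * j) • (TensorAlgebra.ι K y * TensorAlgebra.ι K x))

/-- The vector space `S(V) = ⨁ₙ V^{⊙ n}` underlying the symmetric coalgebra of a graded vector
space `V`, with its (graded commutative) product `⊙`. -/
def SymCoalg (𝒱 : ℤ → Submodule K V) : Type _ := RingQuot (SymRel 𝒱)

namespace SymCoalg

instance instRing (𝒱 : ℤ → Submodule K V) : Ring (SymCoalg 𝒱) :=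
  inferInstanceAs (Ring (RingQuot (SymRel 𝒱)))

instance instAlgebra (𝒱 : ℤ → Submodule K V) : Algebra K (SymCoalg 𝒱) :=
  inferInstanceAs (Algebra K (RingQuot (SymRel 𝒱)))

variable (𝒱 : ℤ → Submodule K V)

/-- The inclusion `V = V^{⊙ 1} → S(V)`. -/
def ι : V →ₗ[K] SymCoalg 𝒱 :=
  (RingQuot.mkAlgHom K (SymRel 𝒱)).toLinearMap ∘ₗ TensorAlgebra.ι K

theorem ι_mul_ι {i j : ℤ} {x y : V} (hx : x ∈ 𝒱 i) (hy : y ∈ 𝒱 j) :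
    ι 𝒱 x * ι 𝒱 y = sgn K (i * j) • (ι 𝒱 y * ι 𝒱 x) := by
  have h := RingQuot.mkAlgHom_rel K (SymRel.comm (𝒱 := 𝒱) i j x y hx hy)
  rw [map_smul, map_mul, map_mul] at h
  exact h

/-- The universal property of `S(V)` as a graded commutative algebra. -/
def lift {A : Type*} [Semiring A] [Algebra K A] (f : V →ₗ[K] A)
    (hf : ∀ (i j : ℤ) (x y : V), x ∈ 𝒱 i → y ∈ 𝒱 j →
      f x * f y = sgn K (i * j) • (f y * f x)) : SymCoalg 𝒱 →ₐ[K] A :=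
  RingQuot.liftAlgHom K ⟨TensorAlgebra.lift K f, by
    rintro _ _ ⟨i, j, x, y, hx, hy⟩
    simpa using hf i j x y hx hy⟩

@[simp]
theorem lift_ι {A : Type*} [Semiring A] [Algebra K A] (f : V →ₗ[K] A)
    (hf : ∀ (i j : ℤ) (x y : V), x ∈ 𝒱 i → y ∈ 𝒱 j →
      f x * f y = sgn K (i * j) • (f y * f x)) (x : V) : lift 𝒱 f hf (ι 𝒱 x) = f x := by
  unfold lift ι
  exact (RingQuot.liftAlgHom_mkAlgHom_apply K _ _ _).trans (TensorAlgebra.lift_ι_apply f x)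

theorem algHom_ext {A : Type*} [Semiring A] [Algebra K A] {f g : SymCoalg 𝒱 →ₐ[K] A}
    (h : ∀ x, f (ι 𝒱 x) = g (ι 𝒱 x)) : f = g := by
  apply RingQuot.ringQuot_ext' K
  apply TensorAlgebra.hom_ext
  ext x
  exact h x

/-- `IsMonomial 𝒱 n d y`: `y = v₁ ⊙ ⋯ ⊙ vₙ` with all `vᵢ` homogeneous and total degree `d`. -/
inductive IsMonomial : ℕ → ℤ → SymCoalg 𝒱 → Prop
  | one : IsMonomial 0 0 1
  | ι_mul {i : ℤ} {n : ℕ} {d : ℤ} {x : V} {y : SymCoalg 𝒱} (hx : x ∈ 𝒱 i) (hy : IsMonomial n d y) :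
      IsMonomial (n + 1) (i + d) (ι 𝒱 x * y)

theorem IsMonomial.ι {i : ℤ} {x : V} (hx : x ∈ 𝒱 i) : IsMonomial 𝒱 1 i (ι 𝒱 x) := by
  have := IsMonomial.ι_mul hx (IsMonomial.one (𝒱 := 𝒱))
  simpa using this

theorem IsMonomial.mul {n m : ℕ} {d e : ℤ} {x y : SymCoalg 𝒱} (hx : IsMonomial 𝒱 n d x)
    (hy : IsMonomial 𝒱 m e y) : IsMonomial 𝒱 (n + m) (d + e) (x * y) := by
  induction hx with
  | one => simpa using hy
  | ι_mul hx _ ih =>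
    rw [mul_assoc, add_assoc (_ : ℤ), Nat.add_right_comm _ 1 m]
    exact IsMonomial.ι_mul hx ih

/-- The span of the monomials `v₁ ⊙ ⋯ ⊙ vₙ` of total degree `d` for which `c (n, d) = a`. -/
def part {A : Type*} [AddCommMonoid A] (c : ℕ × ℤ →+ A) (a : A) : Submodule K (SymCoalg 𝒱) :=
  Submodule.span K {y | ∃ n d, IsMonomial 𝒱 n d y ∧ c (n, d) = a}

section Part

variable {A : Type*} [AddCommMonoid A] (c : ℕ × ℤ →+ A)

theorem IsMonomial.mem_part {n : ℕ} {d : ℤ} {y : SymCoalg 𝒱} (hy : IsMonomial 𝒱 n d y) :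
    y ∈ part 𝒱 c (c (n, d)) :=
  Submodule.subset_span ⟨n, d, hy, rfl⟩

instance part_gradedMonoid : SetLike.GradedMonoid (part 𝒱 c) where
  one_mem := Submodule.subset_span ⟨0, 0, IsMonomial.one, map_zero c⟩
  mul_mem a b x y hx hy := by
    have h := Submodule.mul_mem_mul hx hy
    unfold part at h
    rw [Submodule.span_mul_span] at h
    refine Submodule.span_le.2 ?_ h
    rintro _ ⟨x, ⟨n, d, h1, rfl⟩, y, ⟨m, e, h2, rfl⟩, rfl⟩
    have := (h1.mul 𝒱 h2).mem_part 𝒱 c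
    rw [← map_add]
    exact this

variable [DirectSum.Decomposition 𝒱] [DecidableEq A]

/-- Auxiliary: the map `V → ⨁ₐ part c a` sending `x ∈ 𝒱 i` to `x` in the summand `c (1, i)`. -/
def partι : V →ₗ[K] ⨁ a, part 𝒱 c a :=
  (DirectSum.toModule K ℤ (⨁ a, part 𝒱 c a) fun i =>
    DirectSum.lof K A (fun a => part 𝒱 c a) (c (1, i)) ∘ₗ
      ((ι 𝒱).domRestrict (𝒱 i)).codRestrict _ fun x =>
        (IsMonomial.ι 𝒱 x.2).mem_part 𝒱 c) ∘ₗ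
  (DirectSum.decomposeLinearEquiv 𝒱).toLinearMap

theorem partι_apply {i : ℤ} {x : V} (hx : x ∈ 𝒱 i) :
    partι 𝒱 c x = DirectSum.of (fun a => part 𝒱 c a) (c (1, i))
      ⟨ι 𝒱 x, (IsMonomial.ι 𝒱 hx).mem_part 𝒱 c⟩ := by
  simp only [partι, LinearMap.comp_apply, LinearEquiv.coe_coe, DirectSum.decomposeLinearEquiv_apply]
  rw [DirectSum.decompose_of_mem 𝒱 hx, ← DirectSum.lof_eq_of K, DirectSum.toModule_lof]
  rfl

/-- Auxiliary: the decomposition of `S(V)` into the subspaces `part c a`. -/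
def partHom : SymCoalg 𝒱 →ₐ[K] ⨁ a, part 𝒱 c a :=
  lift 𝒱 (partι 𝒱 c) (by
    intro i j x y hx hy
    rw [partι_apply 𝒱 c hx, partι_apply 𝒱 c hy, DirectSum.of_mul_of, DirectSum.of_mul_of,
      ← DirectSum.lof_eq_of K, ← DirectSum.lof_eq_of K, ← map_smul, DirectSum.lof_eq_of,
      DirectSum.lof_eq_of]
    refine DirectSum.of_eq_of_gradedMonoid_eq (Sigma.subtype_ext (add_comm _ _) ?_)
    exact ι_mul_ι 𝒱 hx hy)

theorem partHom_ι (x : V) : partHom 𝒱 c (ι 𝒱 x) = partι 𝒱 c x := lift_ι ..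

theorem partHom_monomial {n : ℕ} {d : ℤ} {y : SymCoalg 𝒱} (hy : IsMonomial 𝒱 n d y) :
    partHom 𝒱 c y = DirectSum.of (fun a => part 𝒱 c a) (c (n, d)) ⟨y, hy.mem_part 𝒱 c⟩ := by
  induction hy with
  | one =>
    rw [map_one, DirectSum.one_def]
    exact DirectSum.of_eq_of_gradedMonoid_eq (Sigma.subtype_ext (map_zero c).symm rfl)
  | ι_mul hx hy ih =>
    rw [map_mul, partHom_ι, ih, partι_apply 𝒱 c hx, DirectSum.of_mul_of]
    refine DirectSum.of_eq_of_gradedMonoid_eq (Sigma.subtype_ext ?_ rfl)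
    exact (map_add c _ _).symm.trans (by rw [Prod.mk_add_mk, add_comm 1]; rfl)

instance partGradedAlgebra : GradedAlgebra (part 𝒱 c) :=
  GradedAlgebra.ofAlgHom _ (partHom 𝒱 c)
    (by
      apply algHom_ext
      intro x
      induction x using DirectSum.Decomposition.inductionOn 𝒱 with
      | zero => simp
      | add x y hx hy => simp only [map_add, hx, hy]
      | @homogeneous i x =>
        rw [AlgHom.comp_apply, partHom_ι, partι_apply 𝒱 c x.2, DirectSum.coeAlgHom_of]
        rfl)
    (by
      rintro a ⟨x, hx⟩
      refine Submodule.span_induction (p := fun x hx => partHom 𝒱 c x =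
        DirectSum.of (fun a => part 𝒱 c a) a ⟨x, hx⟩) ?_ ?_ ?_ ?_ hx
      · rintro y ⟨n, d, hy, rfl⟩
        exact partHom_monomial 𝒱 c hy
      · rw [map_zero]; exact (map_zero _).symm
      · intro x y hx hy h1 h2
        rw [map_add, h1, h2, ← map_add]; rfl
      · intro r x hx h
        rw [map_smul, h, ← DirectSum.lof_eq_of K, ← map_smul]; rfl)

end Part

theorem induction_monomial [DirectSum.Decomposition 𝒱] {p : SymCoalg 𝒱 → Prop}
    (mono : ∀ n d y, IsMonomial 𝒱 n d y → p y) (zero : p 0) (add : ∀ x y, p x → p y → p (x + y))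
    (smul : ∀ (r : K) x, p x → p (r • x)) (x : SymCoalg 𝒱) : p x := by
  have : x ∈ part 𝒱 (0 : ℕ × ℤ →+ PUnit) 0 := by
    classical
    rw [← DirectSum.sum_support_decompose (part 𝒱 (0 : ℕ × ℤ →+ PUnit)) x]
    exact Submodule.sum_mem _ fun i _ => SetLike.coe_mem _
  refine Submodule.span_induction (p := fun x _ => p x) ?_ zero (fun x y _ _ => add x y)
    (fun r x _ => smul r x) this
  rintro y ⟨n, d, hy, -⟩
  exact mono n d y hy

/-- The elements of `S(V)` of (internal) degree `d`. -/
abbrev degPart (d : ℤ) : Submodule K (SymCoalg 𝒱) := part 𝒱 (AddMonoidHom.snd ℕ ℤ) d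

/-- The symmetric power `V^{⊙ n}`, as a subspace of `S(V)`. -/
abbrev symPow (n : ℕ) : Submodule K (SymCoalg 𝒱) := part 𝒱 (AddMonoidHom.fst ℕ ℤ) n

theorem IsMonomial.mem_degPart {n : ℕ} {d : ℤ} {y : SymCoalg 𝒱} (hy : IsMonomial 𝒱 n d y) :
    y ∈ degPart 𝒱 d := hy.mem_part 𝒱 (AddMonoidHom.snd ℕ ℤ)

theorem IsMonomial.mem_symPow {n : ℕ} {d : ℤ} {y : SymCoalg 𝒱} (hy : IsMonomial 𝒱 n d y) :
    y ∈ symPow 𝒱 n := hy.mem_part 𝒱 (AddMonoidHom.fst ℕ ℤ)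

theorem one_mem_degPart : (1 : SymCoalg 𝒱) ∈ degPart 𝒱 0 := IsMonomial.one.mem_degPart 𝒱

theorem ι_mem_degPart {i : ℤ} {x : V} (hx : x ∈ 𝒱 i) : ι 𝒱 x ∈ degPart 𝒱 i :=
  (IsMonomial.ι 𝒱 hx).mem_degPart 𝒱

/-- The counit `S(V) → K`, i.e. the projection onto `V^{⊙ 0} = K`. -/
def counit : SymCoalg 𝒱 →ₐ[K] K := lift 𝒱 0 (by simp)

@[simp]
theorem counit_ι (x : V) : counit 𝒱 (ι 𝒱 x) = 0 := by simp [counit]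

/-- The projection `S(V) → V^{⊙ 1} = V`. -/
def proj : SymCoalg 𝒱 →ₗ[K] V :=
  letI : Module Kᵐᵒᵖ V := Module.compHom _ ((RingHom.id K).fromOpposite mul_comm)
  haveI : IsCentralScalar K V := ⟨fun _ _ => rfl⟩
  TrivSqZeroExt.sndHom K V ∘ₗ
    (lift 𝒱 (TrivSqZeroExt.inrHom K V) (by simp)).toLinearMap

@[simp]
theorem proj_one : proj 𝒱 1 = 0 := by
  let _ : Module Kᵐᵒᵖ V := Module.compHom _ ((RingHom.id K).fromOpposite mul_comm)
  have : IsCentralScalar K V := ⟨fun _ _ => rfl⟩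
  simp [proj]

theorem proj_ι_mul (v : V) (x : SymCoalg 𝒱) : proj 𝒱 (ι 𝒱 v * x) = counit 𝒱 x • v := by
  let _ : Module Kᵐᵒᵖ V := Module.compHom _ ((RingHom.id K).fromOpposite mul_comm)
  have : IsCentralScalar K V := ⟨fun _ _ => rfl⟩
  have h : (TrivSqZeroExt.fstHom K K V).comp
      (lift 𝒱 (TrivSqZeroExt.inrHom K V) (by simp)) = counit 𝒱 := by
    apply algHom_ext
    intro x
    simp
  have h' := DFunLike.congr_fun h x
  simp only [AlgHom.comp_apply, TrivSqZeroExt.fstHom_apply] at h'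
  simp [proj, h']

@[simp]
theorem proj_ι (v : V) : proj 𝒱 (ι 𝒱 v) = v := by simpa using proj_ι_mul 𝒱 v 1

theorem proj_mem {d : ℤ} {x : SymCoalg 𝒱} (hx : x ∈ degPart 𝒱 d) : proj 𝒱 x ∈ 𝒱 d := by
  refine (Submodule.span_le (p := (𝒱 d).comap (proj 𝒱))).2 ?_ hx
  rintro y ⟨n, d, hy, rfl⟩
  cases hy with
  | one => simp
  | @ι_mul i n d v y hv hy =>
    simp only [SetLike.mem_coe, Submodule.mem_comap, proj_ι_mul]
    cases hy with
    | one => simpa using hv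
    | ι_mul hw hz => simp

theorem IsMonomial.proj_eq_zero {n : ℕ} {d : ℤ} {y : SymCoalg 𝒱} (hy : IsMonomial 𝒱 n d y)
    (hn : n ≠ 1) : proj 𝒱 y = 0 := by
  cases hy with
  | one => simp
  | ι_mul hv hy =>
    cases hy with
    | one => exact absurd rfl hn
    | ι_mul hw hz => simp [proj_ι_mul]

theorem eq_counit_smul_one {y : SymCoalg 𝒱} (hy : y ∈ symPow 𝒱 0) : y = counit 𝒱 y • 1 := by
  refine (Submodule.span_le (p := LinearMap.eqLocus LinearMap.id
    ((counit 𝒱).toLinearMap.smulRight 1))).2 ?_ hy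
  rintro y ⟨n, d, hy, hn⟩
  cases hy with
  | one => simp
  | ι_mul hv hy => simp at hn

theorem map_sub_left (α β γ : SymCoalg 𝒱 →ₗ[K] SymCoalg 𝒱) :
    TensorProduct.map (α - β) γ = TensorProduct.map α γ - TensorProduct.map β γ :=
  TensorProduct.ext' fun x y => by simp [TensorProduct.sub_tmul]

theorem map_sub_right (α β γ : SymCoalg 𝒱 →ₗ[K] SymCoalg 𝒱) :
    TensorProduct.map α (β - γ) = TensorProduct.map α β - TensorProduct.map α γ :=
  TensorProduct.ext' fun x y => by simp [TensorProduct.tmul_sub]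

/-- Homogeneity of a linear map between graded vector spaces: `f` has degree `n`. -/
def HasDegree {M N : Type*} [AddCommGroup M] [Module K M] [AddCommGroup N] [Module K N]
    (ℳ : ℤ → Submodule K M) (𝒩 : ℤ → Submodule K N) (n : ℤ) (f : M →ₗ[K] N) : Prop :=
  ∀ (d : ℤ) (x : M), x ∈ ℳ d → f x ∈ 𝒩 (d + n)

theorem HasDegree.comp {m n : ℤ} {α β : SymCoalg 𝒱 →ₗ[K] SymCoalg 𝒱}
    (hα : HasDegree (degPart 𝒱) (degPart 𝒱) m α) (hβ : HasDegree (degPart 𝒱) (degPart 𝒱) n β) :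
    HasDegree (degPart 𝒱) (degPart 𝒱) (n + m) (α ∘ₗ β) := by
  intro d x hx
  rw [← add_assoc]
  exact hα _ _ (hβ _ _ hx)

variable [DirectSum.Decomposition 𝒱]

/-- The map `x ↦ (-1)^(k * deg x) x`: the Koszul sign for moving an operator of degree `k`
past `x`. -/
def signMap (k : ℤ) : SymCoalg 𝒱 →ₗ[K] SymCoalg 𝒱 :=
  (DirectSum.toModule K ℤ (SymCoalg 𝒱) fun d => sgn K (k * d) • (degPart 𝒱 d).subtype) ∘ₗ
    (DirectSum.decomposeLinearEquiv (degPart 𝒱)).toLinearMap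

theorem signMap_apply (k : ℤ) {d : ℤ} {x : SymCoalg 𝒱} (hx : x ∈ degPart 𝒱 d) :
    signMap 𝒱 k x = sgn K (k * d) • x := by
  simp only [signMap, LinearMap.comp_apply, LinearEquiv.coe_coe,
    DirectSum.decomposeLinearEquiv_apply]
  rw [DirectSum.decompose_of_mem _ hx, ← DirectSum.lof_eq_of K, DirectSum.toModule_lof]
  rfl

theorem uzpow_smul {M : Type*} [AddCommGroup M] [Module K M] (n : ℤ) (x : M) :
    ((-1 : ℤˣ) ^ n) • x = sgn K n • x := by
  rw [sgn, Int.cast_smul_eq_zsmul, Units.smul_def]; rfl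

theorem gtmul_mul_gtmul {i j : ℤ} (a a' b b' : SymCoalg 𝒱) (hb : b ∈ degPart 𝒱 i)
    (ha : a' ∈ degPart 𝒱 j) :
    (GradedTensorProduct.of K (degPart 𝒱) (degPart 𝒱) (a ⊗ₜ b)) *
      (GradedTensorProduct.of K (degPart 𝒱) (degPart 𝒱) (a' ⊗ₜ b')) =
    sgn K (i * j) •
      GradedTensorProduct.of K (degPart 𝒱) (degPart 𝒱) ((a * a') ⊗ₜ (b * b')) := by
  have := GradedTensorProduct.tmul_coe_mul_coe_tmul (R := K) (degPart 𝒱) (degPart 𝒱) a ⟨b, hb⟩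
    ⟨a', ha⟩ b'
  rw [← uzpow_smul]
  exact this

/-- The coproduct of `S(V)`, as the morphism of algebras `S(V) → S(V) ⊗ S(V)` with
`Δ v = v ⊗ 1 + 1 ⊗ v` for `v ∈ V`; the product of `S(V) ⊗ S(V)` follows the Koszul sign rule. -/
def comulAlgHom : SymCoalg 𝒱 →ₐ[K] degPart 𝒱 ᵍ⊗[K] degPart 𝒱 :=
  lift 𝒱
    ((GradedTensorProduct.of K (degPart 𝒱) (degPart 𝒱)).toLinearMap ∘ₗ
      ((TensorProduct.mk K (SymCoalg 𝒱) (SymCoalg 𝒱)).flip 1 + TensorProduct.mk K (SymCoalg 𝒱) (SymCoalg 𝒱) 1) ∘ₗ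
      ι 𝒱)
    (by
      intro i j x y hx hy
      have hx' := ι_mem_degPart 𝒱 hx
      have hy' := ι_mem_degPart 𝒱 hy
      have h1 := one_mem_degPart 𝒱
      simp only [LinearMap.comp_apply, LinearMap.add_apply, LinearMap.flip_apply,
        TensorProduct.mk_apply, LinearEquiv.coe_coe, map_add, add_mul, mul_add]
      rw [gtmul_mul_gtmul 𝒱 _ _ _ _ h1 hy', gtmul_mul_gtmul 𝒱 _ _ _ _ hx' hy',
        gtmul_mul_gtmul 𝒱 _ _ _ _ h1 h1, gtmul_mul_gtmul 𝒱 _ _ _ _ hx' h1,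
        gtmul_mul_gtmul 𝒱 _ _ _ _ h1 hx', gtmul_mul_gtmul 𝒱 _ _ _ _ hy' hx',
        gtmul_mul_gtmul 𝒱 _ _ _ _ hy' h1, gtmul_mul_gtmul 𝒱 _ _ _ _ h1 h1]
      simp only [zero_mul, mul_zero, sgn_zero, one_smul, one_mul, mul_one, ι_mul_ι 𝒱 hx hy,
        smul_add, smul_smul, mul_comm j i, sgn_mul_self, TensorProduct.tmul_smul,
        ← TensorProduct.smul_tmul', map_smul]
      abel)

/-- The coproduct `Δ : S(V) → S(V) ⊗ S(V)`. On `v₁ ⊙ ⋯ ⊙ vₙ` it is the sum over all unshuffles,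
with Koszul signs. -/
def comul : SymCoalg 𝒱 →ₗ[K] SymCoalg 𝒱 ⊗[K] SymCoalg 𝒱 :=
  (GradedTensorProduct.of K (degPart 𝒱) (degPart 𝒱)).symm.toLinearMap ∘ₗ
    (comulAlgHom 𝒱).toLinearMap

@[simp]
theorem comul_one : comul 𝒱 1 = 1 ⊗ₜ 1 := by
  simp [comul, Algebra.TensorProduct.one_def]

theorem comul_ι_mul {i : ℤ} {v : V} (hv : v ∈ 𝒱 i) (x : SymCoalg 𝒱) :
    comul 𝒱 (ι 𝒱 v * x) =
      TensorProduct.map (LinearMap.mulLeft K (ι 𝒱 v)) LinearMap.id (comul 𝒱 x) +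
      TensorProduct.map (signMap 𝒱 i) (LinearMap.mulLeft K (ι 𝒱 v)) (comul 𝒱 x) := by
  have hv' := ι_mem_degPart 𝒱 hv
  have h1 := one_mem_degPart 𝒱
  have key : ∀ z : SymCoalg 𝒱 ⊗[K] SymCoalg 𝒱,
      (GradedTensorProduct.of K (degPart 𝒱) (degPart 𝒱)).symm
        (comulAlgHom 𝒱 (ι 𝒱 v) * GradedTensorProduct.of K (degPart 𝒱) (degPart 𝒱) z) =
      TensorProduct.map (LinearMap.mulLeft K (ι 𝒱 v)) LinearMap.id z +
      TensorProduct.map (signMap 𝒱 i) (LinearMap.mulLeft K (ι 𝒱 v)) z := by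
    intro z
    induction z using TensorProduct.induction_on with
    | zero => simp
    | add x y hx hy =>
      simp only [map_add, mul_add, hx, hy]
      abel
    | tmul a b =>
      induction a using DirectSum.Decomposition.inductionOn (degPart 𝒱) with
      | zero => simp
      | add x y hx hy =>
        simp only [TensorProduct.add_tmul, map_add, mul_add, hx, hy]
        abel
      | @homogeneous j a =>
        rw [comulAlgHom, lift_ι]
        simp only [LinearMap.comp_apply, LinearMap.add_apply, LinearMap.flip_apply,
          TensorProduct.mk_apply, LinearEquiv.coe_coe, map_add, add_mul]
        rw [gtmul_mul_gtmul 𝒱 _ _ _ _ h1 a.2, gtmul_mul_gtmul 𝒱 _ _ _ _ hv' a.2]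
        simp [signMap_apply 𝒱 i a.2, TensorProduct.smul_tmul']
  have := key (comul 𝒱 x)
  rw [← this]
  simp [comul]

/-- For `q : S(V) → V`, the operator
`v₁ ⊙ ⋯ ⊙ vₙ ↦ ∑ ± q (v_σ(1) ⊙ ⋯ ⊙ v_σ(k)) ⊙ v_σ(k+1) ⊙ ⋯ ⊙ v_σ(n)` of `S(V)`, where the sum is
over all `k` and all unshuffles `σ`: the coderivation with corestriction `q`. -/
def hat (q : SymCoalg 𝒱 →ₗ[K] V) : SymCoalg 𝒱 →ₗ[K] SymCoalg 𝒱 :=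
  LinearMap.mul' K (SymCoalg 𝒱) ∘ₗ TensorProduct.map (ι 𝒱 ∘ₗ q) LinearMap.id ∘ₗ comul 𝒱

/-- The span of the `a ⊗ b` for monomials `a`, `b` with `n` factors and of degree `d` in total. -/
def tensorPart (n : ℕ) (d : ℤ) : Submodule K (SymCoalg 𝒱 ⊗[K] SymCoalg 𝒱) :=
  Submodule.span K {z | ∃ n₁ d₁ a n₂ d₂ b, IsMonomial 𝒱 n₁ d₁ a ∧ IsMonomial 𝒱 n₂ d₂ b ∧
    n₁ + n₂ = n ∧ d₁ + d₂ = d ∧ z = a ⊗ₜ b}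

theorem comul_mem_tensorPart {n : ℕ} {d : ℤ} {y : SymCoalg 𝒱} (hy : IsMonomial 𝒱 n d y) :
    comul 𝒱 y ∈ tensorPart 𝒱 n d := by
  induction hy with
  | one =>
    rw [comul_one]
    exact Submodule.subset_span ⟨0, 0, 1, 0, 0, 1, IsMonomial.one, IsMonomial.one, rfl, rfl, rfl⟩
  | @ι_mul i n d v y hv hy ih =>
    rw [comul_ι_mul 𝒱 hv]
    refine Submodule.add_mem _ ?_ ?_
    · refine (Submodule.span_le (p := (tensorPart 𝒱 (n + 1) (i + d)).comap _)).2 ?_ ih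
      rintro _ ⟨n₁, d₁, a, n₂, d₂, b, ha, hb, rfl, rfl, rfl⟩
      exact Submodule.subset_span ⟨_, _, _, _, _, _, IsMonomial.ι_mul hv ha, hb,
        by omega, by omega, rfl⟩
    · refine (Submodule.span_le (p := (tensorPart 𝒱 (n + 1) (i + d)).comap _)).2 ?_ ih
      rintro _ ⟨n₁, d₁, a, n₂, d₂, b, ha, hb, rfl, rfl, rfl⟩
      rw [SetLike.mem_coe, Submodule.mem_comap, TensorProduct.map_tmul,
        signMap_apply 𝒱 i (ha.mem_degPart 𝒱), ← TensorProduct.smul_tmul']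
      exact Submodule.smul_mem _ _ (Submodule.subset_span
        ⟨_, _, _, _, _, _, ha, IsMonomial.ι_mul hv hb, by omega, by omega, rfl⟩)

theorem signMap_ι_mul (k : ℤ) {i : ℤ} {v : V} (hv : v ∈ 𝒱 i) (x : SymCoalg 𝒱) :
    signMap 𝒱 k (ι 𝒱 v * x) = sgn K (k * i) • (ι 𝒱 v * signMap 𝒱 k x) := by
  induction x using DirectSum.Decomposition.inductionOn (degPart 𝒱) with
  | zero => simp
  | add x y hx hy => simp only [mul_add, map_add, hx, hy, smul_add]
  | @homogeneous j a =>
    rw [signMap_apply 𝒱 k a.2, signMap_apply 𝒱 k (SetLike.mul_mem_graded (ι_mem_degPart 𝒱 hv) a.2),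
      mul_add, sgn_add, mul_smul_comm, smul_smul]

@[simp]
theorem signMap_one (k : ℤ) : signMap 𝒱 k 1 = 1 := by
  simp [signMap_apply 𝒱 k (one_mem_degPart 𝒱)]

@[simp]
theorem counit_signMap (k : ℤ) (x : SymCoalg 𝒱) : counit 𝒱 (signMap 𝒱 k x) = counit 𝒱 x := by
  induction x using induction_monomial 𝒱 with
  | mono n d y hy =>
    cases hy with
    | one => simp
    | ι_mul hv hy => simp [signMap_ι_mul 𝒱 k hv]
  | zero => simp
  | add x y hx hy => simp [hx, hy]
  | smul r x hx => simp [hx]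

theorem counit_comul_left (x : SymCoalg 𝒱) :
    TensorProduct.map (counit 𝒱).toLinearMap LinearMap.id (comul 𝒱 x) = (1 : K) ⊗ₜ x := by
  induction x using induction_monomial 𝒱 with
  | mono n d y hy =>
    induction hy with
    | one => simp
    | @ι_mul i n d v y hv hy ih =>
      rw [comul_ι_mul 𝒱 hv, map_add, TensorProduct.map_map, TensorProduct.map_map]
      have h1 : (counit 𝒱).toLinearMap ∘ₗ LinearMap.mulLeft K (ι 𝒱 v) = 0 := by
        ext; simp
      have h2 : (counit 𝒱).toLinearMap ∘ₗ signMap 𝒱 i = (counit 𝒱).toLinearMap := by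
        ext; simp
      rw [h1, h2, TensorProduct.map_zero_left, LinearMap.zero_apply, zero_add]
      have := congrArg (TensorProduct.map LinearMap.id (LinearMap.mulLeft K (ι 𝒱 v))) ih
      rw [TensorProduct.map_map] at this
      simpa using this
  | zero => simp
  | add x y hx hy => simp [hx, hy, TensorProduct.tmul_add]
  | smul r x hx => simp [hx]

theorem counit_comul_right (x : SymCoalg 𝒱) :
    TensorProduct.map LinearMap.id (counit 𝒱).toLinearMap (comul 𝒱 x) = x ⊗ₜ (1 : K) := by
  induction x using induction_monomial 𝒱 with
  | mono n d y hy =>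
    induction hy with
    | one => simp
    | @ι_mul i n d v y hv hy ih =>
      rw [comul_ι_mul 𝒱 hv, map_add, TensorProduct.map_map, TensorProduct.map_map]
      have h1 : (counit 𝒱).toLinearMap ∘ₗ LinearMap.mulLeft K (ι 𝒱 v) = 0 := by
        ext; simp
      rw [h1, TensorProduct.map_zero_right, LinearMap.zero_apply, add_zero]
      have := congrArg (TensorProduct.map (LinearMap.mulLeft K (ι 𝒱 v)) LinearMap.id) ih
      rw [TensorProduct.map_map] at this
      simpa using this
  | zero => simp
  | add x y hx hy => simp [hx, hy, TensorProduct.add_tmul]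
  | smul r x hx => simp [hx, TensorProduct.smul_tmul']

theorem proj_hat_apply (q : SymCoalg 𝒱 →ₗ[K] V) (x : SymCoalg 𝒱) : proj 𝒱 (hat 𝒱 q x) = q x := by
  have h : proj 𝒱 ∘ₗ LinearMap.mul' K (SymCoalg 𝒱) ∘ₗ TensorProduct.map (ι 𝒱 ∘ₗ q) LinearMap.id =
      q ∘ₗ (TensorProduct.rid K (SymCoalg 𝒱)).toLinearMap ∘ₗ
        TensorProduct.map LinearMap.id (counit 𝒱).toLinearMap := by
    apply TensorProduct.ext'
    intro a b
    simp [proj_ι_mul]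
  have := LinearMap.congr_fun h (comul 𝒱 x)
  simp only [LinearMap.comp_apply] at this
  rw [counit_comul_right] at this
  simpa [hat] using this

theorem hat_comp_proj_ι_mul {f : V →ₗ[K] V} (hf : HasDegree 𝒱 𝒱 0 f) {i : ℤ} {v : V}
    (hv : v ∈ 𝒱 i) (x : SymCoalg 𝒱) :
    hat 𝒱 (f ∘ₗ proj 𝒱) (ι 𝒱 v * x) = ι 𝒱 (f v) * x + ι 𝒱 v * hat 𝒱 (f ∘ₗ proj 𝒱) x := by
  simp only [hat, LinearMap.comp_apply, comul_ι_mul 𝒱 hv, map_add]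
  congr 1
  · have h : LinearMap.mul' K (SymCoalg 𝒱) ∘ₗ TensorProduct.map (ι 𝒱 ∘ₗ f ∘ₗ proj 𝒱) LinearMap.id ∘ₗ
        TensorProduct.map (LinearMap.mulLeft K (ι 𝒱 v)) LinearMap.id =
        LinearMap.mulLeft K (ι 𝒱 (f v)) ∘ₗ (TensorProduct.lid K (SymCoalg 𝒱)).toLinearMap ∘ₗ
          TensorProduct.map (counit 𝒱).toLinearMap LinearMap.id := by
      apply TensorProduct.ext'
      intro a b
      simp [proj_ι_mul]
    have := LinearMap.congr_fun h (comul 𝒱 x)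
    simp only [LinearMap.comp_apply] at this
    rw [counit_comul_left] at this
    simpa using this
  · have h : LinearMap.mul' K (SymCoalg 𝒱) ∘ₗ TensorProduct.map (ι 𝒱 ∘ₗ f ∘ₗ proj 𝒱) LinearMap.id ∘ₗ
        TensorProduct.map (signMap 𝒱 i) (LinearMap.mulLeft K (ι 𝒱 v)) =
        LinearMap.mulLeft K (ι 𝒱 v) ∘ₗ LinearMap.mul' K (SymCoalg 𝒱) ∘ₗ
          TensorProduct.map (ι 𝒱 ∘ₗ f ∘ₗ proj 𝒱) LinearMap.id := by
      apply TensorProduct.ext'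
      intro a b
      induction a using DirectSum.Decomposition.inductionOn (degPart 𝒱) with
      | zero => simp
      | add x y hx hy => simp only [TensorProduct.add_tmul, map_add, hx, hy]
      | @homogeneous j a =>
        have ha := hf _ _ (proj_mem 𝒱 a.2)
        rw [add_zero] at ha
        simp only [LinearMap.comp_apply, TensorProduct.map_tmul, signMap_apply 𝒱 i a.2,
          LinearMap.mul'_apply, LinearMap.mulLeft_apply, LinearMap.id_apply, map_smul,
          smul_mul_assoc]
        rw [← mul_assoc, ← mul_assoc, ι_mul_ι 𝒱 hv ha, smul_mul_assoc]
    exact LinearMap.congr_fun h (comul 𝒱 x)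

theorem hat_one (q : SymCoalg 𝒱 →ₗ[K] V) : hat 𝒱 q 1 = ι 𝒱 (q 1) := by simp [hat]

theorem hat_hasDegree {q : SymCoalg 𝒱 →ₗ[K] V} {n : ℤ} (hq : HasDegree (degPart 𝒱) 𝒱 n q) :
    HasDegree (degPart 𝒱) (degPart 𝒱) n (hat 𝒱 q) := by
  intro d x hx
  refine (Submodule.span_le (p := (degPart 𝒱 (d + n)).comap (hat 𝒱 q))).2 ?_ hx
  rintro y ⟨m, d, hy, rfl⟩
  refine (Submodule.span_le (p := (degPart 𝒱 (d + n)).comap (LinearMap.mul' K (SymCoalg 𝒱) ∘ₗ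
    TensorProduct.map (ι 𝒱 ∘ₗ q) LinearMap.id))).2 ?_ (comul_mem_tensorPart 𝒱 hy)
  rintro _ ⟨n₁, d₁, a, n₂, d₂, b, ha, hb, rfl, rfl, rfl⟩
  simp only [SetLike.mem_coe, Submodule.mem_comap, LinearMap.comp_apply, TensorProduct.map_tmul,
    LinearMap.mul'_apply, LinearMap.id_apply]
  have := SetLike.mul_mem_graded (ι_mem_degPart 𝒱 (hq _ _ (ha.mem_degPart 𝒱))) (hb.mem_degPart 𝒱)
  rwa [add_right_comm] at this

/-- The graded flip `a ⊗ b ↦ (-1)^(deg a * deg b) b ⊗ a`. -/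
def braid : SymCoalg 𝒱 ⊗[K] SymCoalg 𝒱 →ₗ[K] SymCoalg 𝒱 ⊗[K] SymCoalg 𝒱 :=
  (GradedTensorProduct.of K (degPart 𝒱) (degPart 𝒱)).symm.toLinearMap ∘ₗ
    (GradedTensorProduct.comm (degPart 𝒱) (degPart 𝒱)).toLinearMap ∘ₗ
    (GradedTensorProduct.of K (degPart 𝒱) (degPart 𝒱)).toLinearMap

theorem braid_tmul {i j : ℤ} {a b : SymCoalg 𝒱} (ha : a ∈ degPart 𝒱 i) (hb : b ∈ degPart 𝒱 j) :
    braid 𝒱 (a ⊗ₜ b) = sgn K (j * i) • (b ⊗ₜ a) := by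
  have := GradedTensorProduct.comm_coe_tmul_coe (R := K) (degPart 𝒱) (degPart 𝒱) ⟨a, ha⟩ ⟨b, hb⟩
  rw [uzpow_smul (K := K)] at this
  exact this

theorem braid_comul (x : SymCoalg 𝒱) : braid 𝒱 (comul 𝒱 x) = comul 𝒱 x := by
  have h : (GradedTensorProduct.comm (degPart 𝒱) (degPart 𝒱)).toAlgHom.comp (comulAlgHom 𝒱) =
      comulAlgHom 𝒱 := by
    apply algHom_ext
    intro v
    induction v using DirectSum.Decomposition.inductionOn 𝒱 with
    | zero => simp
    | add x y hx hy => simp only [map_add, hx, hy]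
    | @homogeneous j v =>
      have h1 := one_mem_degPart 𝒱
      have hv := ι_mem_degPart 𝒱 v.2
      have e1 := GradedTensorProduct.comm_coe_tmul_coe (R := K) (degPart 𝒱) (degPart 𝒱)
        ⟨_, h1⟩ ⟨_, hv⟩
      have e2 := GradedTensorProduct.comm_coe_tmul_coe (R := K) (degPart 𝒱) (degPart 𝒱)
        ⟨_, hv⟩ ⟨_, h1⟩
      rw [uzpow_smul (K := K)] at e1 e2
      simp only [mul_zero, zero_mul, sgn_zero, one_smul] at e1 e2
      rw [AlgHom.comp_apply, comulAlgHom, lift_ι]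
      simp only [LinearMap.comp_apply, LinearMap.add_apply, LinearMap.flip_apply,
        TensorProduct.mk_apply, LinearEquiv.coe_coe, map_add]
      refine (congrArg₂ (· + ·) e2 e1).trans (add_comm _ _)
  exact congrArg (GradedTensorProduct.of K (degPart 𝒱) (degPart 𝒱)).symm (DFunLike.congr_fun h x)

theorem comul_signMap (k : ℤ) (x : SymCoalg 𝒱) :
    comul 𝒱 (signMap 𝒱 k x) = TensorProduct.map (signMap 𝒱 k) (signMap 𝒱 k) (comul 𝒱 x) := by
  induction x using induction_monomial 𝒱 with
  | mono n d y hy =>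
    rw [signMap_apply 𝒱 k (hy.mem_degPart 𝒱), map_smul]
    refine (Submodule.span_le (p := LinearMap.eqLocus (sgn K (k * d) • LinearMap.id)
      (TensorProduct.map (signMap 𝒱 k) (signMap 𝒱 k)))).2 ?_ (comul_mem_tensorPart 𝒱 hy)
    rintro _ ⟨n₁, d₁, a, n₂, d₂, b, ha, hb, rfl, rfl, rfl⟩
    simp [signMap_apply 𝒱 k (ha.mem_degPart 𝒱), signMap_apply 𝒱 k (hb.mem_degPart 𝒱), mul_add,
      sgn_add, TensorProduct.smul_tmul', smul_smul, mul_comm]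
  | zero => simp
  | add x y hx hy => simp [hx, hy]
  | smul r x hx => simp [hx]

theorem comul_coassoc (x : SymCoalg 𝒱) :
    TensorProduct.assoc K _ _ _ (TensorProduct.map (comul 𝒱) LinearMap.id (comul 𝒱 x)) =
      TensorProduct.map LinearMap.id (comul 𝒱) (comul 𝒱 x) := by
  induction x using induction_monomial 𝒱 with
  | mono n d y hy =>
    induction hy with
    | one => simp
    | @ι_mul i n d v y hv hy ih =>
      set L := LinearMap.mulLeft K (ι 𝒱 v) with hL
      set s := signMap 𝒱 i with hs
      let T : SymCoalg 𝒱 ⊗[K] (SymCoalg 𝒱 ⊗[K] SymCoalg 𝒱) →ₗ[K] SymCoalg 𝒱 ⊗[K] (SymCoalg 𝒱 ⊗[K] SymCoalg 𝒱) :=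
        TensorProduct.map L LinearMap.id +
        TensorProduct.map s (TensorProduct.map L LinearMap.id) +
        TensorProduct.map s (TensorProduct.map s L)
      have hΔL : ∀ a, comul 𝒱 (L a) = TensorProduct.map L LinearMap.id (comul 𝒱 a) +
          TensorProduct.map s L (comul 𝒱 a) := fun a => comul_ι_mul 𝒱 hv a
      have hΔs : ∀ a, comul 𝒱 (s a) = TensorProduct.map s s (comul 𝒱 a) := comul_signMap 𝒱 i
      have e1 : ∀ z : SymCoalg 𝒱 ⊗[K] SymCoalg 𝒱,
          TensorProduct.assoc K _ _ _ (TensorProduct.map (comul 𝒱) LinearMap.id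
            (TensorProduct.map L LinearMap.id z + TensorProduct.map s L z)) =
          T (TensorProduct.assoc K _ _ _ (TensorProduct.map (comul 𝒱) LinearMap.id z)) := by
        intro z
        induction z using TensorProduct.induction_on with
        | zero => simp
        | add x y hx hy =>
          simp only [map_add] at hx hy ⊢
          rw [← hx, ← hy]
          abel
        | tmul a b =>
          simp only [TensorProduct.map_tmul, map_add, LinearMap.id_apply, hΔL, hΔs,
            TensorProduct.add_tmul]
          generalize comul 𝒱 a = w
          induction w using TensorProduct.induction_on with
          | zero => simp
          | add x y hx hy =>
            simp only [map_add, TensorProduct.add_tmul] at hx hy ⊢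
            rw [← hx, ← hy]
            abel
          | tmul c d => simp [T]
      have e2 : ∀ z : SymCoalg 𝒱 ⊗[K] SymCoalg 𝒱,
          TensorProduct.map LinearMap.id (comul 𝒱)
            (TensorProduct.map L LinearMap.id z + TensorProduct.map s L z) =
          T (TensorProduct.map LinearMap.id (comul 𝒱) z) := by
        intro z
        induction z using TensorProduct.induction_on with
        | zero => simp
        | add x y hx hy =>
          simp only [map_add] at hx hy ⊢
          rw [← hx, ← hy]
          abel
        | tmul a b =>
          simp only [TensorProduct.map_tmul, map_add, LinearMap.id_apply, hΔL,
            TensorProduct.tmul_add]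
          simp [T, add_assoc]
      rw [comul_ι_mul 𝒱 hv, e1, e2, ih]
  | zero => simp
  | add x y hx hy => simp only [map_add, hx, hy]
  | smul r x hx => simp only [map_smul, hx]

/-- `α : S(V) → S(V)` is a coderivation of degree `n`: it is homogeneous of degree `n` and
`Δ α = (α ⊗ id + id ⊗ α) Δ`, with the Koszul sign `(id ⊗ α)(x ⊗ y) = (-1)^(n * deg x) x ⊗ α y`. -/
structure IsCoderivation (n : ℤ) (α : SymCoalg 𝒱 →ₗ[K] SymCoalg 𝒱) : Prop where
  hasDegree : HasDegree (degPart 𝒱) (degPart 𝒱) n α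
  comul_comp : comul 𝒱 ∘ₗ α =
    (TensorProduct.map α LinearMap.id + TensorProduct.map (signMap 𝒱 n) α) ∘ₗ comul 𝒱

theorem isCoderivation_hat {q : SymCoalg 𝒱 →ₗ[K] V} {n : ℤ} (hq : HasDegree (degPart 𝒱) 𝒱 n q) :
    IsCoderivation 𝒱 n (hat 𝒱 q) where
  hasDegree := hat_hasDegree 𝒱 hq
  comul_comp := by
    set m : SymCoalg 𝒱 ⊗[K] SymCoalg 𝒱 →ₗ[K] SymCoalg 𝒱 :=
      LinearMap.mul' K (SymCoalg 𝒱) ∘ₗ TensorProduct.map (ι 𝒱 ∘ₗ q) LinearMap.id with hm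
    let A : (SymCoalg 𝒱 ⊗[K] SymCoalg 𝒱) ⊗[K] SymCoalg 𝒱 →ₗ[K] SymCoalg 𝒱 ⊗[K] (SymCoalg 𝒱 ⊗[K] SymCoalg 𝒱) :=
      (TensorProduct.assoc K _ _ _).toLinearMap
    let A' : SymCoalg 𝒱 ⊗[K] (SymCoalg 𝒱 ⊗[K] SymCoalg 𝒱) →ₗ[K] (SymCoalg 𝒱 ⊗[K] SymCoalg 𝒱) ⊗[K] SymCoalg 𝒱 :=
      (TensorProduct.assoc K _ _ _).symm.toLinearMap
    have key : ∀ z, comul 𝒱 (m z) =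
        TensorProduct.map m LinearMap.id (A' (TensorProduct.map LinearMap.id (comul 𝒱) z)) +
        TensorProduct.map (signMap 𝒱 n) m (A (TensorProduct.map (braid 𝒱) LinearMap.id
          (A' (TensorProduct.map LinearMap.id (comul 𝒱) z)))) := by
      intro z
      induction z using TensorProduct.induction_on with
      | zero => simp
      | add x y hx hy =>
        simp only [map_add, hx, hy]
        abel
      | tmul a b =>
        induction a using DirectSum.Decomposition.inductionOn (degPart 𝒱) with
        | zero => simp
        | add x y hx hy =>
          simp only [map_add, TensorProduct.add_tmul, hx, hy]
          abel
        | @homogeneous d a =>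
          have hqa := hq d a a.2
          simp only [hm, LinearMap.comp_apply, TensorProduct.map_tmul, LinearMap.mul'_apply,
            LinearMap.id_apply]
          rw [comul_ι_mul 𝒱 hqa]
          generalize comul 𝒱 b = w
          induction w using TensorProduct.induction_on with
          | zero => simp
          | add x y hx hy =>
            simp only [map_add, TensorProduct.tmul_add] at hx hy ⊢
            rw [add_add_add_comm, hx, hy]
            abel
          | tmul b c =>
            induction b using DirectSum.Decomposition.inductionOn (degPart 𝒱) with
            | zero => simp
            | add x y hx hy =>
              simp only [map_add, TensorProduct.tmul_add, TensorProduct.add_tmul] at hx hy ⊢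
              rw [add_add_add_comm, hx, hy]
              abel
            | @homogeneous e b =>
              simp only [A, A', LinearEquiv.coe_coe, TensorProduct.assoc_symm_tmul,
                TensorProduct.map_tmul, braid_tmul 𝒱 a.2 b.2, ← TensorProduct.smul_tmul', map_smul,
                TensorProduct.assoc_tmul, signMap_apply 𝒱 _ b.2, LinearMap.comp_apply,
                LinearMap.mul'_apply, LinearMap.id_apply, LinearMap.mulLeft_apply, smul_smul,
                add_mul, sgn_add, mul_comm e d]
    ext x
    have h1 : A' (TensorProduct.map LinearMap.id (comul 𝒱) (comul 𝒱 x)) =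
        TensorProduct.map (comul 𝒱) LinearMap.id (comul 𝒱 x) := by
      rw [← comul_coassoc]
      exact LinearEquiv.symm_apply_apply _ _
    have h2 : TensorProduct.map (braid 𝒱) LinearMap.id
        (TensorProduct.map (comul 𝒱) LinearMap.id (comul 𝒱 x)) =
        TensorProduct.map (comul 𝒱) LinearMap.id (comul 𝒱 x) := by
      rw [TensorProduct.map_map]
      congr 2
      ext y
      exact braid_comul 𝒱 y
    have h3 : A (TensorProduct.map (comul 𝒱) LinearMap.id (comul 𝒱 x)) =
        TensorProduct.map LinearMap.id (comul 𝒱) (comul 𝒱 x) := comul_coassoc 𝒱 x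
    have h := key (comul 𝒱 x)
    rw [h1, h2, h3, TensorProduct.map_map, TensorProduct.map_map] at h
    exact h

theorem hat_comp_proj_monomial {f : V →ₗ[K] V} {c : ℤ → K}
    (hf : ∀ i v, v ∈ 𝒱 i → f v = c i • v) {w : ℕ → ℤ → K} (hw₀ : w 0 0 = 0)
    (hw : ∀ n i d, w (n + 1) (i + d) = c i + w n d) {n : ℕ} {d : ℤ} {y : SymCoalg 𝒱}
    (hy : IsMonomial 𝒱 n d y) : hat 𝒱 (f ∘ₗ proj 𝒱) y = w n d • y := by
  have hf' : HasDegree 𝒱 𝒱 0 f := by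
    intro i v hv
    rw [hf i v hv, add_zero]
    exact Submodule.smul_mem _ _ hv
  induction hy with
  | one => simp [hat_one, hw₀]
  | ι_mul hv hy ih =>
    rw [hat_comp_proj_ι_mul 𝒱 hf' hv, ih, hf _ _ hv, hw, map_smul, smul_mul_assoc, mul_smul_comm,
      add_smul]

theorem hat_proj_symPow {n : ℕ} {y : SymCoalg 𝒱} (hy : y ∈ symPow 𝒱 n) :
    hat 𝒱 (proj 𝒱) y = (n : K) • y := by
  refine (Submodule.span_le (p := LinearMap.eqLocus (hat 𝒱 (proj 𝒱))
    ((n : K) • LinearMap.id))).2 ?_ hy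
  rintro y ⟨n, d, h, rfl⟩
  have := hat_comp_proj_monomial 𝒱 (f := LinearMap.id) (c := fun _ => 1) (w := fun n _ => (n : K))
    (by simp) (by simp) (by intro n _ _; push_cast; ring) h
  simpa using this

theorem eq_zero_of_hat_proj_eq_zero [CharZero K] {y : SymCoalg 𝒱} (h : hat 𝒱 (proj 𝒱) y = 0)
    (h' : counit 𝒱 y = 0) : y = 0 := by
  have key : ∀ z : SymCoalg 𝒱, ∀ n : ℕ, (DirectSum.decompose (symPow 𝒱) (hat 𝒱 (proj 𝒱) z) n : SymCoalg 𝒱) =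
      (n : K) • (DirectSum.decompose (symPow 𝒱) z n : SymCoalg 𝒱) := by
    intro z n
    induction z using DirectSum.Decomposition.inductionOn (symPow 𝒱) with
    | zero => simp
    | add x y hx hy => simp [hx, hy, DirectSum.decompose_add]
    | @homogeneous j a =>
      rw [hat_proj_symPow 𝒱 a.2, DirectSum.decompose_smul, DirectSum.smul_apply,
        Submodule.coe_smul]
      by_cases hj : j = n
      · subst hj; rfl
      · rw [DirectSum.decompose_of_mem_ne _ a.2 hj, smul_zero, smul_zero]
  have h0 : ∀ n : ℕ, n ≠ 0 → (DirectSum.decompose (symPow 𝒱) y n : SymCoalg 𝒱) = 0 := by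
    intro n hn
    have := key y n
    rw [h] at this
    simpa [hn] using this.symm
  have hy : y ∈ symPow 𝒱 0 := by
    classical
    rw [← DirectSum.sum_support_decompose (symPow 𝒱) y]
    refine Submodule.sum_mem _ fun n _ => ?_
    by_cases hn : n = 0
    · subst hn; exact SetLike.coe_mem _
    · rw [h0 n hn]; exact Submodule.zero_mem _
  rw [eq_counit_smul_one 𝒱 hy, h', zero_smul]

/-- A coderivation is determined on `⨁_{k < p} V^{⊙ k}` by its corestriction there. -/
theorem IsCoderivation.eq_zero [CharZero K] {n : ℤ} {α : SymCoalg 𝒱 →ₗ[K] SymCoalg 𝒱}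
    (hα : IsCoderivation 𝒱 n α) (p : ℕ)
    (h : ∀ k < p, ∀ x ∈ symPow 𝒱 k, proj 𝒱 (α x) = 0) :
    ∀ k < p, ∀ x ∈ symPow 𝒱 k, α x = 0 := by
  intro k
  induction k using Nat.strong_induction_on with
  | _ k ih =>
    intro hk x hx
    refine (Submodule.span_le (p := LinearMap.ker α)).2 ?_ hx
    rintro y ⟨k, d, hy, rfl⟩
    change k < p at hk
    rw [SetLike.mem_coe, LinearMap.mem_ker]
    have hΔ := LinearMap.congr_fun hα.comul_comp y
    simp only [LinearMap.comp_apply, LinearMap.add_apply] at hΔ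
    apply eq_zero_of_hat_proj_eq_zero 𝒱
    · simp only [hat, LinearMap.comp_apply]
      rw [hΔ, ← LinearMap.add_apply]
      refine (Submodule.span_le (p := LinearMap.ker (LinearMap.mul' K (SymCoalg 𝒱) ∘ₗ
        TensorProduct.map (ι 𝒱 ∘ₗ proj 𝒱) LinearMap.id ∘ₗ
        (TensorProduct.map α LinearMap.id + TensorProduct.map (signMap 𝒱 n) α)))).2 ?_
        (comul_mem_tensorPart 𝒱 hy)
      rintro _ ⟨n₁, d₁, a, n₂, d₂, b, ha, hb, hn, hd, rfl⟩
      have h1 : proj 𝒱 (α a) = 0 := h n₁ (by omega) a (ha.mem_symPow 𝒱)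
      simp only [SetLike.mem_coe, LinearMap.mem_ker, LinearMap.comp_apply, LinearMap.add_apply,
        map_add, TensorProduct.map_tmul, LinearMap.mul'_apply, h1, map_zero, zero_mul, zero_add,
        signMap_apply 𝒱 n (ha.mem_degPart 𝒱), map_smul, smul_mul_assoc, LinearMap.id_apply]
      by_cases h2 : n₁ = 1
      · rw [ih n₂ (by change n₂ < k; omega) (by omega) b (hb.mem_symPow 𝒱), mul_zero, smul_zero]
      · rw [ha.proj_eq_zero 𝒱 h2, map_zero, zero_mul, smul_zero]
    · have e1 : ∀ z, TensorProduct.lid K K (TensorProduct.map (counit 𝒱).toLinearMap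
          (counit 𝒱).toLinearMap (TensorProduct.map α LinearMap.id z)) =
          TensorProduct.lid K K (TensorProduct.map ((counit 𝒱).toLinearMap ∘ₗ α) LinearMap.id
            (TensorProduct.map LinearMap.id (counit 𝒱).toLinearMap z)) := by
        intro z
        rw [TensorProduct.map_map, TensorProduct.map_map]; rfl
      have hs : (counit 𝒱).toLinearMap ∘ₗ signMap 𝒱 n = (counit 𝒱).toLinearMap := by
        ext; simp
      have e2 : ∀ z, TensorProduct.lid K K (TensorProduct.map (counit 𝒱).toLinearMap
          (counit 𝒱).toLinearMap (TensorProduct.map (signMap 𝒱 n) α z)) =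
          TensorProduct.lid K K (TensorProduct.map LinearMap.id ((counit 𝒱).toLinearMap ∘ₗ α)
            (TensorProduct.map (counit 𝒱).toLinearMap LinearMap.id z)) := by
        intro z
        rw [TensorProduct.map_map, TensorProduct.map_map, hs]; rfl
      have e3 : ∀ z, TensorProduct.lid K K (TensorProduct.map (counit 𝒱).toLinearMap
          (counit 𝒱).toLinearMap (comul 𝒱 z)) = counit 𝒱 z := by
        intro z
        have : TensorProduct.map (counit 𝒱).toLinearMap (counit 𝒱).toLinearMap (comul 𝒱 z) =
          TensorProduct.map LinearMap.id (counit 𝒱).toLinearMap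
            (TensorProduct.map (counit 𝒱).toLinearMap LinearMap.id (comul 𝒱 z)) := by
          rw [TensorProduct.map_map]; rfl
        rw [this, counit_comul_left]
        simp
      have := e3 (α y)
      rw [hΔ, map_add, map_add, e1, e2, counit_comul_left, counit_comul_right] at this
      simpa using this

theorem IsCoderivation.sub {n : ℤ} {α β : SymCoalg 𝒱 →ₗ[K] SymCoalg 𝒱} (hα : IsCoderivation 𝒱 n α)
    (hβ : IsCoderivation 𝒱 n β) : IsCoderivation 𝒱 n (α - β) where
  hasDegree d x hx := Submodule.sub_mem _ (hα.hasDegree d x hx) (hβ.hasDegree d x hx)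
  comul_comp := by
    rw [LinearMap.comp_sub, hα.comul_comp, hβ.comul_comp, map_sub_left,
      map_sub_right, ← LinearMap.sub_comp]
    congr 1
    abel

theorem IsCoderivation.eq_zero_of_proj [CharZero K] {n : ℤ} {α : SymCoalg 𝒱 →ₗ[K] SymCoalg 𝒱}
    (hα : IsCoderivation 𝒱 n α) (h : ∀ x, proj 𝒱 (α x) = 0) : α = 0 := by
  ext x
  induction x using induction_monomial 𝒱 with
  | mono n d y hy =>
    exact hα.eq_zero 𝒱 (n + 1) (fun _ _ x _ => h x) n (Nat.lt_succ_self n) y (hy.mem_symPow 𝒱)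
  | zero => simp
  | add x y hx hy => rw [map_add, hx, hy]; simp
  | smul r x hx => rw [map_smul, hx]; simp

theorem IsCoderivation.ext [CharZero K] {n : ℤ} {α β : SymCoalg 𝒱 →ₗ[K] SymCoalg 𝒱}
    (hα : IsCoderivation 𝒱 n α) (hβ : IsCoderivation 𝒱 n β)
    (h : ∀ x, proj 𝒱 (α x) = proj 𝒱 (β x)) : α = β :=
  sub_eq_zero.1 ((hα.sub 𝒱 hβ).eq_zero_of_proj 𝒱 fun x => by simp [h x])

theorem IsCoderivation.eq_hat [CharZero K] {n : ℤ} {α : SymCoalg 𝒱 →ₗ[K] SymCoalg 𝒱}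
    (hα : IsCoderivation 𝒱 n α) : α = hat 𝒱 (proj 𝒱 ∘ₗ α) :=
  hα.ext 𝒱 (isCoderivation_hat 𝒱 fun d x hx => proj_mem 𝒱 (hα.hasDegree d x hx))
    fun x => (proj_hat_apply 𝒱 (proj 𝒱 ∘ₗ α) x).symm

theorem signMap_comp {n : ℤ} {α : SymCoalg 𝒱 →ₗ[K] SymCoalg 𝒱}
    (hα : HasDegree (degPart 𝒱) (degPart 𝒱) n α) (k : ℤ) :
    signMap 𝒱 k ∘ₗ α = sgn K (k * n) • (α ∘ₗ signMap 𝒱 k) := by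
  ext x
  induction x using DirectSum.Decomposition.inductionOn (degPart 𝒱) with
  | zero => simp
  | add x y hx hy => rw [map_add, hx, hy, map_add]
  | @homogeneous d x =>
    simp [signMap_apply 𝒱 k x.2, signMap_apply 𝒱 k (hα d x x.2), mul_add, sgn_add, smul_smul,
      mul_comm]

theorem signMap_comp_signMap (k l : ℤ) : signMap 𝒱 k ∘ₗ signMap 𝒱 l = signMap 𝒱 (k + l) := by
  ext x
  induction x using DirectSum.Decomposition.inductionOn (degPart 𝒱) with
  | zero => simp
  | add x y hx hy => rw [map_add, hx, hy, map_add]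
  | @homogeneous d x =>
    simp [signMap_apply 𝒱 _ x.2, add_mul, sgn_add, smul_smul, mul_comm (sgn K (k * d))]

/-- The graded commutator of a coderivation of degree one with a coderivation. -/
theorem IsCoderivation.commutator {n : ℤ} {Q α : SymCoalg 𝒱 →ₗ[K] SymCoalg 𝒱} (hQ : IsCoderivation 𝒱 1 Q)
    (hα : IsCoderivation 𝒱 n α) :
    IsCoderivation 𝒱 (n + 1) (Q ∘ₗ α - sgn K n • (α ∘ₗ Q)) where
  hasDegree d x hx := by
    refine Submodule.sub_mem _ (HasDegree.comp 𝒱 hQ.hasDegree hα.hasDegree d x hx)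
      (Submodule.smul_mem _ _ ?_)
    have := HasDegree.comp 𝒱 hα.hasDegree hQ.hasDegree d x hx
    rwa [add_comm 1 n] at this
  comul_comp := by
    have h1 : comul 𝒱 ∘ₗ Q ∘ₗ α =
        (TensorProduct.map (Q ∘ₗ α) LinearMap.id + sgn K n • TensorProduct.map (signMap 𝒱 n ∘ₗ Q) α
          + TensorProduct.map (signMap 𝒱 1 ∘ₗ α) Q +
          TensorProduct.map (signMap 𝒱 (n + 1)) (Q ∘ₗ α)) ∘ₗ comul 𝒱 := by
      rw [← LinearMap.comp_assoc, hQ.comul_comp, LinearMap.comp_assoc, hα.comul_comp,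
        ← LinearMap.comp_assoc, signMap_comp 𝒱 hQ.hasDegree, add_comm n 1, ← signMap_comp_signMap]
      congr 1
      simp only [LinearMap.add_comp, LinearMap.comp_add, ← TensorProduct.map_comp,
        LinearMap.id_comp, LinearMap.comp_id, TensorProduct.map_smul_left, smul_smul, mul_one,
        sgn_mul_self, one_smul]
      abel
    have h2 : comul 𝒱 ∘ₗ α ∘ₗ Q =
        (TensorProduct.map (α ∘ₗ Q) LinearMap.id + TensorProduct.map (signMap 𝒱 n ∘ₗ Q) α
          + sgn K n • TensorProduct.map (signMap 𝒱 1 ∘ₗ α) Q +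
          TensorProduct.map (signMap 𝒱 (n + 1)) (α ∘ₗ Q)) ∘ₗ comul 𝒱 := by
      rw [← LinearMap.comp_assoc, hα.comul_comp, LinearMap.comp_assoc, hQ.comul_comp,
        ← LinearMap.comp_assoc, signMap_comp 𝒱 hα.hasDegree, ← signMap_comp_signMap]
      congr 1
      simp only [LinearMap.add_comp, LinearMap.comp_add, ← TensorProduct.map_comp,
        LinearMap.id_comp, LinearMap.comp_id, TensorProduct.map_smul_left, smul_smul, one_mul,
        sgn_mul_self, one_smul]
      abel
    rw [LinearMap.comp_sub, LinearMap.comp_smul, h1, h2, ← LinearMap.smul_comp,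
      ← LinearMap.sub_comp]
    congr 1
    simp only [smul_add, smul_smul, sgn_mul_self, one_smul, map_sub_left,
      map_sub_right, TensorProduct.map_smul_left, TensorProduct.map_smul_right]
    abel

/-- The projection `S(V) → V^{⊙ k} ⊆ S(V)`. -/
def symProj (k : ℕ) : SymCoalg 𝒱 →ₗ[K] SymCoalg 𝒱 := GradedAlgebra.proj (symPow 𝒱) k

theorem symProj_of_mem {k : ℕ} {x : SymCoalg 𝒱} (hx : x ∈ symPow 𝒱 k) : symProj 𝒱 k x = x := by
  rw [symProj, GradedAlgebra.proj_apply]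
  exact DirectSum.decompose_of_mem_same _ hx

theorem symProj_of_mem_ne {k l : ℕ} {x : SymCoalg 𝒱} (hx : x ∈ symPow 𝒱 l) (h : l ≠ k) :
    symProj 𝒱 k x = 0 := by
  rw [symProj, GradedAlgebra.proj_apply]
  exact DirectSum.decompose_of_mem_ne _ hx h

theorem symProj_hasDegree (k : ℕ) : HasDegree (degPart 𝒱) (degPart 𝒱) 0 (symProj 𝒱 k) := by
  intro d x hx
  rw [add_zero]
  refine (Submodule.span_le (p := (degPart 𝒱 d).comap (symProj 𝒱 k))).2 ?_ hx
  rintro y ⟨n, d, hy, rfl⟩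
  rw [SetLike.mem_coe, Submodule.mem_comap]
  by_cases h : n = k
  · subst h
    rw [symProj_of_mem 𝒱 (hy.mem_symPow 𝒱)]
    exact hy.mem_degPart 𝒱
  · rw [symProj_of_mem_ne 𝒱 (hy.mem_symPow 𝒱) h]
    exact Submodule.zero_mem _

/-- If `q` vanishes on `V^{⊙ 0}`, then `hat q` does not increase the number of factors. -/
theorem comp_hat_eq_zero {M : Type*} [AddCommGroup M] [Module K M] {q : SymCoalg 𝒱 →ₗ[K] V}
    (hq : q 1 = 0) {α : SymCoalg 𝒱 →ₗ[K] M} {p : ℤ}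
    (hα : ∀ i : ℕ, (i : ℤ) < p → ∀ x ∈ symPow 𝒱 i, α x = 0) {k : ℕ} (hk : (k : ℤ) < p) {x : SymCoalg 𝒱}
    (hx : x ∈ symPow 𝒱 k) : α (hat 𝒱 q x) = 0 := by
  refine (Submodule.span_le (p := LinearMap.ker (α ∘ₗ hat 𝒱 q))).2 ?_ hx
  rintro y ⟨k, d, hy, rfl⟩
  change (k : ℤ) < p at hk
  refine (Submodule.span_le (p := LinearMap.ker (α ∘ₗ LinearMap.mul' K (SymCoalg 𝒱) ∘ₗ
    TensorProduct.map (ι 𝒱 ∘ₗ q) LinearMap.id))).2 ?_ (comul_mem_tensorPart 𝒱 hy)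
  rintro _ ⟨n₁, d₁, a, n₂, d₂, b, ha, hb, rfl, rfl, rfl⟩
  simp only [SetLike.mem_coe, LinearMap.mem_ker, LinearMap.comp_apply, TensorProduct.map_tmul,
    LinearMap.mul'_apply, LinearMap.id_apply]
  rcases Nat.eq_zero_or_pos n₁ with rfl | hn
  · cases ha with
    | one => simp [hq]
  · have h1 : ι 𝒱 (q a) ∈ symPow 𝒱 1 := by
      generalize q a = v
      induction v using DirectSum.Decomposition.inductionOn 𝒱 with
      | zero => simp
      | add x y hx hy => rw [map_add]; exact Submodule.add_mem _ hx hy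
      | @homogeneous i v => exact (IsMonomial.ι 𝒱 v.2).mem_symPow 𝒱
    exact hα (1 + n₂) (by push_cast at hk ⊢; omega) _
      (SetLike.mul_mem_graded h1 (hb.mem_symPow 𝒱))

/-- If `q` is supported on `V^{⊙ k}`, then `hat q` maps `V^{⊙ l}` to `V^{⊙ (l-k+1)}`. -/
theorem hat_mem_symPow {q : SymCoalg 𝒱 →ₗ[K] V} {k : ℕ}
    (hq : ∀ l, l ≠ k → ∀ x ∈ symPow 𝒱 l, q x = 0) {l m : ℕ} (hm : l + 1 = m + k) {x : SymCoalg 𝒱}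
    (hx : x ∈ symPow 𝒱 l) : hat 𝒱 q x ∈ symPow 𝒱 m := by
  refine (Submodule.span_le (p := (symPow 𝒱 m).comap (hat 𝒱 q))).2 ?_ hx
  rintro y ⟨l, d, hy, rfl⟩
  change l + 1 = m + k at hm
  refine (Submodule.span_le (p := (symPow 𝒱 m).comap (LinearMap.mul' K (SymCoalg 𝒱) ∘ₗ
    TensorProduct.map (ι 𝒱 ∘ₗ q) LinearMap.id))).2 ?_ (comul_mem_tensorPart 𝒱 hy)
  rintro _ ⟨n₁, d₁, a, n₂, d₂, b, ha, hb, rfl, rfl, rfl⟩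
  simp only [SetLike.mem_coe, Submodule.mem_comap, LinearMap.comp_apply, TensorProduct.map_tmul,
    LinearMap.mul'_apply, LinearMap.id_apply]
  by_cases h : n₁ = k
  · have h1 : ι 𝒱 (q a) ∈ symPow 𝒱 1 := by
      generalize q a = v
      induction v using DirectSum.Decomposition.inductionOn 𝒱 with
      | zero => simp
      | add x y hx hy => rw [map_add]; exact Submodule.add_mem _ hx hy
      | @homogeneous i v => exact (IsMonomial.ι 𝒱 v.2).mem_symPow 𝒱
    have := SetLike.mul_mem_graded h1 (hb.mem_symPow 𝒱)
    rwa [show 1 + n₂ = m by omega] at this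
  · rw [hq _ h _ (ha.mem_symPow 𝒱)]
    simp

end SymCoalg

/-- A filtered complex: subspaces `F p n = F^p M^n` and `deg n = M^n` of an ambient vector space,
and differentials `d n : M^n → M^(n+1)` (only the values of `d n` on `M^n` matter). -/
structure FilteredComplex (K A : Type*) [Field K] [AddCommGroup A] [Module K A] where
  deg : ℤ → Submodule K A
  F : ℤ → ℤ → Submodule K A
  d : ℤ → A →ₗ[K] A
  F_le_deg : ∀ p n, F p n ≤ deg n
  F_antitone : ∀ p p' n, p ≤ p' → F p' n ≤ F p n
  d_mem_deg : ∀ n x, x ∈ deg n → d n x ∈ deg (n + 1)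
  d_mem_F : ∀ p n x, x ∈ F p n → d n x ∈ F p (n + 1)
  d_d : ∀ n x, x ∈ deg n → d (n + 1) (d n x) = 0

namespace FilteredComplex

variable {A : Type*} [AddCommGroup A] [Module K A] (C : FilteredComplex K A)

/-- `Z^{p,q}_r = {x ∈ F^p M^(p+q) | d x ∈ F^(p+r) M^(p+q+1)}`. -/
def Z (p q r : ℤ) : Submodule K A :=
  C.F p (p + q) ⊓ (C.F (p + r) (p + q + 1)).comap (C.d (p + q))

/-- `Z^{p+1,q-1}_{r-1} + d Z^{p-r+1,q+r-2}_{r-1}`. -/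
def B (p q r : ℤ) : Submodule K A :=
  C.Z (p + 1) (q - 1) (r - 1) ⊔
    (C.Z (p - r + 1) (q + r - 2) (r - 1)).map (C.d (p - r + 1 + (q + r - 2)))

theorem B_le_Z (p q r : ℤ) : C.B p q r ≤ C.Z p q r := by
  refine sup_le ?_ ?_
  · rintro x ⟨h1, h2⟩
    rw [SetLike.mem_coe] at h1
    rw [SetLike.mem_coe, Submodule.mem_comap] at h2
    rw [show p + 1 + (q - 1) = p + q by ring] at h1 h2
    rw [show p + 1 + (r - 1) = p + r by ring] at h2
    exact ⟨C.F_antitone _ _ _ (by omega) h1, h2⟩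
  · rintro _ ⟨x, ⟨h1, h2⟩, rfl⟩
    have h3 := C.d_d _ _ (C.F_le_deg _ _ h1)
    rw [SetLike.mem_coe, Submodule.mem_comap] at h2
    rw [show p - r + 1 + (r - 1) = p by ring, show p - r + 1 + (q + r - 2) + 1 = p + q by ring]
      at h2
    rw [show p - r + 1 + (q + r - 2) + 1 = p + q by ring] at h3
    refine ⟨h2, ?_⟩
    rw [SetLike.mem_coe, Submodule.mem_comap, h3]
    exact Submodule.zero_mem _

theorem mem_Z_succ {p q r : ℤ} {x : A} (hx : x ∈ C.Z p q (r + 1)) : x ∈ C.Z p q r :=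
  ⟨hx.1, C.F_antitone _ _ _ (by omega) hx.2⟩

theorem d_mem_Z {p q r : ℤ} {x : A} (hx : x ∈ C.Z p q r) :
    C.d (p + q) x ∈ C.Z (p + r) (q - r + 1) r := by
  have h3 := C.d_d _ _ (C.F_le_deg _ _ hx.1)
  have h2 := hx.2
  rw [SetLike.mem_coe, Submodule.mem_comap] at h2
  rw [Z, show p + r + (q - r + 1) = p + q + 1 by ring]
  refine ⟨h2, ?_⟩
  rw [SetLike.mem_coe, Submodule.mem_comap, h3]
  exact Submodule.zero_mem _

/-- The term `E^{p,q}_r` of the spectral sequence of a filtered complex. -/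
abbrev E (p q r : ℤ) : Type _ := C.Z p q r ⧸ (C.B p q r).submoduleOf (C.Z p q r)

/-- The class in `E^{p,q}_r` of an element of `Z^{p,q}_r`. -/
def cls {p q r : ℤ} (x : A) (hx : x ∈ C.Z p q r) : C.E p q r :=
  Submodule.Quotient.mk ⟨x, hx⟩

theorem cls_eq_cls {p q r : ℤ} {x y : A} {hx : x ∈ C.Z p q r} {hy : y ∈ C.Z p q r} :
    C.cls x hx = C.cls y hy ↔ x - y ∈ C.B p q r := by
  rw [cls, cls, Submodule.Quotient.eq]
  rfl

/-- The differential `d_r : E^{p,q}_r → E^{p+r,q-r+1}_r` induced by `d`. -/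
def dr (p q r : ℤ) : C.E p q r →ₗ[K] C.E (p + r) (q - r + 1) r :=
  Submodule.mapQ _ _
    (((C.d (p + q)).domRestrict (C.Z p q r)).codRestrict (C.Z (p + r) (q - r + 1) r)
      fun x => C.d_mem_Z x.2)
    (by
      rintro ⟨x, hx⟩ hxB
      change x ∈ C.B p q r at hxB
      change C.d (p + q) x ∈ C.B (p + r) (q - r + 1) r
      obtain ⟨y, hy, _, ⟨z, hz, rfl⟩, rfl⟩ := Submodule.mem_sup.1 hxB
      have h3 := C.d_d _ _ (C.F_le_deg _ _ hz.1)
      rw [show p - r + 1 + (q + r - 2) + 1 = p + q by ring] at h3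
      rw [map_add, h3, add_zero]
      refine Submodule.mem_sup_right ⟨y, ?_, ?_⟩
      · rwa [show p + r - r + 1 = p + 1 by ring, show q - r + 1 + r - 2 = q - 1 by ring]
      · rw [show p + r - r + 1 + (q - r + 1 + r - 2) = p + q by ring])

theorem dr_cls {p q r : ℤ} (x : A) (hx : x ∈ C.Z p q r) :
    C.dr p q r (C.cls x hx) = C.cls (C.d (p + q) x) (C.d_mem_Z hx) := rfl

/-- `y ∈ E^{p,q}_{r+1}` is the class of `x ∈ E^{p,q}_r`, under the natural isomorphism
`E_{r+1} ≅ ker d_r / im d_r`. -/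
def IsNext {p q r : ℤ} (x : C.E p q r) (y : C.E p q (r + 1)) : Prop :=
  ∃ (z : A) (hz : z ∈ C.Z p q (r + 1)), C.cls z (C.mem_Z_succ hz) = x ∧ C.cls z hz = y

/-- An element of `E_r` has a class in `E_{r+1}` if and only if it is a `d_r`-cocycle. -/
theorem exists_isNext_iff {p q r : ℤ} (x : C.E p q r) :
    (∃ y, C.IsNext x y) ↔ C.dr p q r x = 0 := by
  constructor
  · rintro ⟨_, z, hz, rfl, -⟩
    rw [dr_cls, ← map_zero (Submodule.mkQ _)]
    refine (C.cls_eq_cls (hy := Submodule.zero_mem _)).2 ?_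
    rw [sub_zero]
    refine Submodule.mem_sup_left ⟨?_, ?_⟩
    · have := hz.2
      rw [SetLike.mem_coe, Submodule.mem_comap] at this
      rwa [show p + r + 1 + (q - r + 1 - 1) = p + q + 1 by ring, add_assoc]
    · have h3 := C.d_d _ _ (C.F_le_deg _ _ hz.1)
      rw [SetLike.mem_coe, Submodule.mem_comap,
        show p + r + 1 + (q - r + 1 - 1) = p + q + 1 by ring, h3]
      exact Submodule.zero_mem _
  · obtain ⟨⟨x, hx⟩, rfl⟩ := Submodule.Quotient.mk_surjective _ x
    intro h
    change C.dr p q r (C.cls x hx) = 0 at h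
    rw [dr_cls, ← map_zero (Submodule.mkQ _)] at h
    have h := (C.cls_eq_cls (hy := Submodule.zero_mem _)).1 h
    rw [sub_zero] at h
    obtain ⟨a, ha, _, ⟨b, hb, rfl⟩, hab⟩ := Submodule.mem_sup.1 h
    have ha1 := ha.1
    have hb1 := hb.1
    rw [SetLike.mem_coe] at ha1 hb1 hb
    rw [show p + r - r + 1 = p + 1 by ring, show q - r + 1 + r - 2 = q - 1 by ring] at hb hb1 hab
    rw [show p + r + 1 + (q - r + 1 - 1) = p + q + 1 by ring] at ha1
    rw [show p + 1 + (q - 1) = p + q by ring] at hb1 hab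
    have hz : x - b ∈ C.Z p q (r + 1) := by
      refine ⟨Submodule.sub_mem _ hx.1 (C.F_antitone _ _ _ (by omega) hb1), ?_⟩
      rw [SetLike.mem_coe, Submodule.mem_comap, map_sub, ← hab, add_sub_cancel_right, ← add_assoc]
      exact ha1
    refine ⟨C.cls _ hz, x - b, hz, ?_, rfl⟩
    refine C.cls_eq_cls.2 ?_
    rw [sub_sub_cancel_left]
    exact Submodule.mem_sup_left (Submodule.neg_mem _ hb)

/-- The class in `E_{r+1}` of an element of `E_r` is unique. -/
theorem IsNext.unique {p q r : ℤ} {x : C.E p q r} {y y' : C.E p q (r + 1)} (h : C.IsNext x y)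
    (h' : C.IsNext x y') : y = y' := by
  obtain ⟨z, hz, rfl, rfl⟩ := h
  obtain ⟨z', hz', h, rfl⟩ := h'
  have h := C.cls_eq_cls.1 h.symm
  obtain ⟨a, ha, c, ⟨b, hb, hbc⟩, hab⟩ := Submodule.mem_sup.1 h
  have hb' : b ∈ C.Z (p - r) (q + r - 1) r := by
    have h1 := hb.1
    have h2 := hb.2
    rw [SetLike.mem_coe] at h1
    rw [SetLike.mem_coe, Submodule.mem_comap] at h2
    rw [show p - r + 1 + (q + r - 2) = p - r + (q + r - 1) by ring] at h1 h2
    rw [show p - r + 1 + (r - 1) = p - r + r by ring] at h2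
    exact ⟨C.F_antitone _ _ _ (by omega) h1, h2⟩
  have hdc : C.d (p + q) c = 0 := by
    rw [← hbc]
    have := C.d_d _ _ (C.F_le_deg _ _ hb.1)
    rwa [show p - r + 1 + (q + r - 2) + 1 = p + q by ring] at this
  refine C.cls_eq_cls.2 ?_
  rw [← hab]
  refine Submodule.add_mem _ (Submodule.mem_sup_left ?_) (Submodule.mem_sup_right ?_)
  · refine ⟨ha.1, ?_⟩
    have hzz := (Submodule.sub_mem _ hz hz').2
    rw [SetLike.mem_coe, Submodule.mem_comap, ← hab, map_add, hdc, add_zero] at hzz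
    rw [SetLike.mem_coe, Submodule.mem_comap, show p + 1 + (q - 1) = p + q by ring,
      show p + 1 + (r + 1 - 1) = p + (r + 1) by ring]
    exact hzz
  · refine ⟨b, ?_, ?_⟩
    · rwa [show p - (r + 1) + 1 = p - r by ring, show q + (r + 1) - 2 = q + r - 1 by ring,
        add_sub_cancel_right]
    · rw [← hbc, show p - (r + 1) + 1 + (q + (r + 1) - 2) = p - r + 1 + (q + r - 2) by ring]

/-- The spectral sequence degenerates at `E_k`: `d_r = 0` for every `r ≥ k`. -/
def DegeneratesAt (k : ℤ) : Prop := ∀ r, k ≤ r → ∀ p q, C.dr p q r = 0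

/-- For `e ∈ E^{p,q}_k`: `d_r e = 0` in `E_r` for every `r ≥ k`. Here `e` is regarded as an element
`ε r` of `E_r` recursively: since `d_r (ε r) = 0`, it has a class `ε (r + 1)` in `E_{r+1}`. -/
def AllDifferentialsVanish {p q k : ℤ} (e : C.E p q k) : Prop :=
  ∃ ε : ∀ r : ℤ, C.E p q r, ε k = e ∧
    ∀ r, k ≤ r → C.dr p q r (ε r) = 0 ∧ C.IsNext (ε r) (ε (r + 1))

end FilteredComplex

open SymCoalg

/-- The space `Coder^n(S(V), S(V))` of coderivations of degree `n`. -/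
def Coder (𝒱 : ℤ → Submodule K V) [DirectSum.Decomposition 𝒱] (n : ℤ) :
    Submodule K (SymCoalg 𝒱 →ₗ[K] SymCoalg 𝒱) where
  carrier := {α | IsCoderivation 𝒱 n α}
  zero_mem' := ⟨fun _ _ _ => Submodule.zero_mem _, by simp⟩
  add_mem' := by
    intro α β hα hβ
    refine ⟨fun d x hx => Submodule.add_mem _ (hα.hasDegree d x hx) (hβ.hasDegree d x hx), ?_⟩
    rw [LinearMap.comp_add, hα.comul_comp, hβ.comul_comp, TensorProduct.map_add_left,
      TensorProduct.map_add_right, ← LinearMap.add_comp]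
    congr 1
    abel
  smul_mem' := by
    intro r α hα
    refine ⟨fun d x hx => Submodule.smul_mem _ _ (hα.hasDegree d x hx), ?_⟩
    rw [LinearMap.comp_smul, hα.comul_comp, TensorProduct.map_smul_left,
      TensorProduct.map_smul_right, ← smul_add, LinearMap.smul_comp]

/-- The linear maps `α` with `α (V^{⊙ i}) = 0` for all `i < p`. -/
def vanishingBelow (𝒱 : ℤ → Submodule K V) (p : ℤ) : Submodule K (SymCoalg 𝒱 →ₗ[K] SymCoalg 𝒱) where
  carrier := {α | ∀ i : ℕ, (i : ℤ) < p → ∀ x ∈ symPow 𝒱 i, α x = 0}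
  zero_mem' _ _ _ _ := rfl
  add_mem' := by
    intro α β hα hβ i hi x hx
    rw [LinearMap.add_apply, hα i hi x hx, hβ i hi x hx, add_zero]
  smul_mem' := by
    intro r α hα i hi x hx
    rw [LinearMap.smul_apply, hα i hi x hx, smul_zero]

/-- A morphism of symmetric coalgebras `S(V) → S(W)`: a morphism of graded augmented coalgebras. -/
structure IsCoalgHom {W : Type*} [AddCommGroup W] [Module K W] (𝒱 : ℤ → Submodule K V)
    (𝒲 : ℤ → Submodule K W) [DirectSum.Decomposition 𝒱] [DirectSum.Decomposition 𝒲]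
    (f : SymCoalg 𝒱 →ₗ[K] SymCoalg 𝒲) : Prop where
  hasDegree : HasDegree (degPart 𝒱) (degPart 𝒲) 0 f
  comul_comp : comul 𝒲 ∘ₗ f = TensorProduct.map f f ∘ₗ comul 𝒱
  counit_comp : (counit 𝒲).toLinearMap ∘ₗ f = (counit 𝒱).toLinearMap
  map_one : f 1 = 1

/-- An `L∞[1]`-algebra structure on the graded vector space `V = ⨁ 𝒱 i`: a coderivation `Q` of
`S(V)` of degree `1` with `Q 1 = 0` and `Q Q = 0`. -/
structure LInfinityOneAlgebra (𝒱 : ℤ → Submodule K V) [DirectSum.Decomposition 𝒱] where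
  Q : SymCoalg 𝒱 →ₗ[K] SymCoalg 𝒱
  isCoderivation : IsCoderivation 𝒱 1 Q
  map_one : Q 1 = 0
  sq_zero : Q ∘ₗ Q = 0

/-- An `L∞`-morphism `f : (V, Q) ⇢ (W, R)`. -/
structure IsLInfinityMorphism {W : Type*} [AddCommGroup W] [Module K W] {𝒱 : ℤ → Submodule K V}
    {𝒲 : ℤ → Submodule K W} [DirectSum.Decomposition 𝒱] [DirectSum.Decomposition 𝒲]
    (L : LInfinityOneAlgebra 𝒱) (M : LInfinityOneAlgebra 𝒲) (f : SymCoalg 𝒱 →ₗ[K] SymCoalg 𝒲) : Prop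
    extends IsCoalgHom 𝒱 𝒲 f where
  comp_Q : f ∘ₗ L.Q = M.Q ∘ₗ f

/-- An `L∞`-isomorphism: a bijective `L∞`-morphism. -/
def IsLInfinityIso {W : Type*} [AddCommGroup W] [Module K W] {𝒱 : ℤ → Submodule K V}
    {𝒲 : ℤ → Submodule K W} [DirectSum.Decomposition 𝒱] [DirectSum.Decomposition 𝒲]
    (L : LInfinityOneAlgebra 𝒱) (M : LInfinityOneAlgebra 𝒲) (f : SymCoalg 𝒱 →ₗ[K] SymCoalg 𝒲) : Prop :=
  IsLInfinityMorphism L M f ∧ Function.Bijective f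

namespace LInfinityOneAlgebra

variable {𝒱 : ℤ → Submodule K V} [DirectSum.Decomposition 𝒱] (L : LInfinityOneAlgebra 𝒱)

/-- The bracket `q_k = Q^1_k : V^{⊙ k} → V`, extended by zero to `S(V)`. -/
def bracket (k : ℕ) : SymCoalg 𝒱 →ₗ[K] V := proj 𝒱 ∘ₗ L.Q ∘ₗ symProj 𝒱 k

/-- An `L∞[1]`-algebra is minimal if `q_1 = 0`. -/
def IsMinimal : Prop := L.bracket 1 = 0

theorem bracket_apply {k : ℕ} {x : SymCoalg 𝒱} (hx : x ∈ symPow 𝒱 k) :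
    L.bracket k x = proj 𝒱 (L.Q x) := by
  simp [bracket, symProj_of_mem 𝒱 hx]

theorem bracket_apply_ne {k l : ℕ} (h : l ≠ k) {x : SymCoalg 𝒱} (hx : x ∈ symPow 𝒱 l) :
    L.bracket k x = 0 := by
  simp [bracket, symProj_of_mem_ne 𝒱 hx h]

theorem bracket_hasDegree (k : ℕ) : HasDegree (degPart 𝒱) 𝒱 1 (L.bracket k) := by
  intro d x hx
  have h := symProj_hasDegree 𝒱 k d x hx
  rw [add_zero] at h
  exact proj_mem 𝒱 (L.isCoderivation.hasDegree _ _ h)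

theorem proj_Q_zero {x : SymCoalg 𝒱} (hx : x ∈ symPow 𝒱 0) : proj 𝒱 (L.Q x) = 0 := by
  rw [eq_counit_smul_one 𝒱 hx, map_smul, L.map_one, smul_zero, map_zero]

variable [CharZero K]

theorem quadratic_sq_zero (hL : L.IsMinimal) :
    hat 𝒱 (L.bracket 2) ∘ₗ hat 𝒱 (L.bracket 2) = 0 := by
  have h2 := isCoderivation_hat 𝒱 (L.bracket_hasDegree 2)
  have h3 := isCoderivation_hat 𝒱 (L.bracket_hasDegree 3)
  have hproj1 : ∀ y ∈ symPow 𝒱 1, proj 𝒱 (L.Q y) = 0 := by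
    intro y hy
    rw [← L.bracket_apply hy, show L.bracket 1 = 0 from hL, LinearMap.zero_apply]
  have hQ : ∀ x ∈ symPow 𝒱 3, L.Q x = hat 𝒱 (L.bracket 2) x + hat 𝒱 (L.bracket 3) x := by
    intro x hx
    have h := ((L.isCoderivation.sub 𝒱 h2).sub 𝒱 h3).eq_zero 𝒱 4 ?_ 3 (by norm_num) x hx
    · rw [LinearMap.sub_apply, LinearMap.sub_apply, sub_sub] at h
      exact sub_eq_zero.1 h
    · intro k hk x hx
      rw [LinearMap.sub_apply, LinearMap.sub_apply, map_sub, map_sub, proj_hat_apply,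
        proj_hat_apply]
      interval_cases k
      · rw [L.proj_Q_zero hx, L.bracket_apply_ne (by norm_num) hx,
          L.bracket_apply_ne (by norm_num) hx, sub_zero, sub_zero]
      · rw [hproj1 x hx, L.bracket_apply_ne (by norm_num) hx,
          L.bracket_apply_ne (by norm_num) hx, sub_zero, sub_zero]
      · rw [L.bracket_apply hx, L.bracket_apply_ne (by norm_num) hx, sub_self, sub_zero]
      · rw [L.bracket_apply hx, L.bracket_apply_ne (by norm_num) hx, sub_zero, sub_self]
  have key : ∀ x, L.bracket 2 (hat 𝒱 (L.bracket 2) x) = 0 := by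
    intro x
    induction x using induction_monomial 𝒱 with
    | mono n d y hy =>
      have hy := hy.mem_symPow 𝒱
      rcases Nat.eq_zero_or_pos n with rfl | hn
      · rw [eq_counit_smul_one 𝒱 hy, map_smul, hat_one,
          L.bracket_apply_ne (k := 2) (l := 0) (by norm_num) (IsMonomial.one.mem_symPow 𝒱)]
        simp
      · have hm := hat_mem_symPow 𝒱 (k := 2) (fun l hl x hx => L.bracket_apply_ne hl hx)
          (l := n) (m := n - 1) (by omega) hy
        by_cases hn3 : n = 3
        · subst hn3
          have hm3 := hat_mem_symPow 𝒱 (k := 3) (fun l hl x hx => L.bracket_apply_ne hl hx)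
            (l := 3) (m := 1) (by omega) hy
          have h := congrArg (proj 𝒱) (LinearMap.congr_fun L.sq_zero y)
          rw [LinearMap.comp_apply, hQ y hy, map_add, map_add, hproj1 _ hm3, add_zero,
            ← L.bracket_apply hm] at h
          simpa using h
        · exact L.bracket_apply_ne (by omega) hm
    | zero => simp
    | add x y hx hy => simp [hx, hy]
    | smul r x hx => simp [hx]
  have h := (h2.commutator 𝒱 h2).eq_zero_of_proj 𝒱 (by
    intro x
    simp [proj_hat_apply, key])
  have h1 := neg_smul (1 : K) (hat 𝒱 (L.bracket 2) ∘ₗ hat 𝒱 (L.bracket 2))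
  rw [sgn_one, h1, one_smul, sub_neg_eq_add, ← two_smul K] at h
  exact (smul_eq_zero.1 h).resolve_left two_ne_zero

/-- The `L∞[1]`-algebra `(V, 0, q_2, 0, 0, …)` attached to a minimal `L∞[1]`-algebra
`(V, 0, q_2, q_3, …)`. -/
def quadraticPart (hL : L.IsMinimal) : LInfinityOneAlgebra 𝒱 where
  Q := hat 𝒱 (L.bracket 2)
  isCoderivation := isCoderivation_hat 𝒱 (L.bracket_hasDegree 2)
  map_one := by
    rw [hat_one, L.bracket_apply_ne (k := 2) (l := 0) (by norm_num) (IsMonomial.one.mem_symPow 𝒱),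
      map_zero]
  sq_zero := L.quadratic_sq_zero hL

/-- The Chevalley–Eilenberg complex `CE(V, V)`: coderivations of `S(V)`, with the differential
`d α = Q α - (-1)^(deg α) α Q` and the filtration `F^p = {α | α (V^{⊙ i}) = 0 for all i < p}`. -/
def CE : FilteredComplex K (SymCoalg 𝒱 →ₗ[K] SymCoalg 𝒱) where
  deg n := Coder 𝒱 n
  F p n := Coder 𝒱 n ⊓ vanishingBelow 𝒱 p
  d n := LinearMap.mulLeft K L.Q - sgn K n • LinearMap.mulRight K L.Q
  F_le_deg _ _ _ h := h.1
  F_antitone p p' n hp α h := ⟨h.1, fun i hi => h.2 i (hi.trans_le hp)⟩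
  d_mem_deg n α hα := L.isCoderivation.commutator 𝒱 hα
  d_mem_F p n α hα := by
    refine ⟨L.isCoderivation.commutator 𝒱 hα.1, fun i hi x hx => ?_⟩
    have h := comp_hat_eq_zero 𝒱 (q := proj 𝒱 ∘ₗ L.Q) (by simp [L.map_one]) hα.2 hi hx
    rw [← L.isCoderivation.eq_hat 𝒱] at h
    change L.Q (α x) - sgn K n • α (L.Q x) = 0
    rw [h, hα.2 i hi x hx, map_zero, smul_zero, sub_zero]
  d_d n α _ := by
    have hQ : L.Q * L.Q = 0 := L.sq_zero
    change L.Q * (L.Q * α - sgn K n • (α * L.Q)) -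
      sgn K (n + 1) • ((L.Q * α - sgn K n • (α * L.Q)) * L.Q) = 0
    rw [sgn_add, sgn_one]
    simp only [mul_sub, sub_mul, mul_smul_comm, smul_mul_assoc, ← mul_assoc, hQ, zero_mul]
    simp only [mul_assoc, hQ, mul_zero, smul_zero, sub_zero, zero_sub, mul_neg,
      mul_one]
    have h := neg_smul (sgn K n) (L.Q * (α * L.Q))
    rw [h, sub_self]

end LInfinityOneAlgebra

/-- The linear map `e : V → V`, `e v = (deg v + 1) v`. -/
def eulerMap (𝒱 : ℤ → Submodule K V) [DirectSum.Decomposition 𝒱] : V →ₗ[K] V :=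
  (DirectSum.toModule K ℤ V fun i => ((i : K) + 1) • (𝒱 i).subtype) ∘ₗ
    (DirectSum.decomposeLinearEquiv 𝒱).toLinearMap

theorem eulerMap_apply (𝒱 : ℤ → Submodule K V) [DirectSum.Decomposition 𝒱] {i : ℤ} {v : V}
    (hv : v ∈ 𝒱 i) : eulerMap 𝒱 v = ((i : K) + 1) • v := by
  simp only [eulerMap, LinearMap.comp_apply, LinearEquiv.coe_coe,
    DirectSum.decomposeLinearEquiv_apply]
  rw [DirectSum.decompose_of_mem _ hv, ← DirectSum.lof_eq_of K, DirectSum.toModule_lof]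
  rfl

/-- The Euler derivation, as the coderivation of `S(V)` with corestriction `e : V → V`. -/
def eulerDerivation (𝒱 : ℤ → Submodule K V) [DirectSum.Decomposition 𝒱] : SymCoalg 𝒱 →ₗ[K] SymCoalg 𝒱 :=
  hat 𝒱 (eulerMap 𝒱 ∘ₗ proj 𝒱)

namespace LInfinityOneAlgebra

variable {𝒱 : ℤ → Submodule K V} [DirectSum.Decomposition 𝒱] (L : LInfinityOneAlgebra 𝒱)
variable [CharZero K]

theorem eulerDerivation_mem_Z (hL : L.IsMinimal) : eulerDerivation 𝒱 ∈ L.CE.Z 1 (-1) 2 := by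
  have hdeg : HasDegree (degPart 𝒱) 𝒱 0 (eulerMap 𝒱 ∘ₗ proj 𝒱) := by
    intro d x hx
    rw [LinearMap.comp_apply, eulerMap_apply 𝒱 (proj_mem 𝒱 hx), add_zero]
    exact Submodule.smul_mem _ _ (proj_mem 𝒱 hx)
  have hcod : IsCoderivation 𝒱 0 (eulerDerivation 𝒱) := isCoderivation_hat 𝒱 hdeg
  have hcom := L.isCoderivation.commutator 𝒱 hcod
  refine ⟨⟨hcod, fun i hi x hx => ?_⟩, hcom, fun i hi x hx => ?_⟩
  · obtain rfl : i = 0 := by omega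
    rw [eq_counit_smul_one 𝒱 hx, map_smul, eulerDerivation, hat_one]
    simp
  · refine hcom.eq_zero 𝒱 3 ?_ i (by omega) x hx
    intro k hk x hx
    refine (Submodule.span_le (p := LinearMap.ker (proj 𝒱 ∘ₗ _))).2 ?_ hx
    rintro y ⟨k, d, hy, rfl⟩
    change k < 3 at hk
    have he : eulerDerivation 𝒱 y = ((k : K) + d) • y :=
      hat_comp_proj_monomial 𝒱 (c := fun i => (i : K) + 1) (w := fun n d => (n : K) + d)
        (fun i v hv => eulerMap_apply 𝒱 hv) (by simp) (by intro n i d; push_cast; ring) hy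
    have hpe : proj 𝒱 (eulerDerivation 𝒱 (L.Q y)) = ((d : K) + 2) • proj 𝒱 (L.Q y) := by
      rw [eulerDerivation, proj_hat_apply, LinearMap.comp_apply,
        eulerMap_apply 𝒱 (proj_mem 𝒱 (L.isCoderivation.hasDegree _ _ (hy.mem_degPart 𝒱)))]
      push_cast
      ring_nf
    have hzero : k ≠ 2 → proj 𝒱 (L.Q y) = 0 := by
      intro h2
      have hy' := hy.mem_symPow 𝒱
      have : k = 0 ∨ k = 1 := by omega
      rcases this with rfl | rfl
      · exact L.proj_Q_zero hy'
      · rw [← L.bracket_apply hy', show L.bracket 1 = 0 from hL, LinearMap.zero_apply]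
    simp only [SetLike.mem_coe, LinearMap.mem_ker, LinearMap.comp_apply, LinearMap.sub_apply,
      sgn_zero, one_smul, map_sub, he, hpe, map_smul]
    by_cases h2 : k = 2
    · subst h2
      rw [← sub_smul]
      push_cast
      ring_nf
      simp
    · simp [hzero h2]

/-- The Euler class `e ∈ E(V, V)^{1,-1}_2` of a minimal `L∞[1]`-algebra: the class of the Euler
derivation. -/
def eulerClass (hL : L.IsMinimal) : L.CE.E 1 (-1) 2 :=
  L.CE.cls (eulerDerivation 𝒱) (L.eulerDerivation_mem_Z hL)

end LInfinityOneAlgebra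

end

end LInfinity

/-!
All three conditions are equivalent to the existence of a cocycle `z` of degree `0` in `CE(V, V)`
which agrees with the Euler derivation `e` modulo `F^2`.

* If `d_r(e) = 0` for every `r ≥ 2`, then `e` can be corrected successively by elements of `F^2` to
  cocycles modulo higher and higher powers of the filtration. Correcting the cocycle modulo `F^r`
  could disturb its lower order terms. This is avoided because `z` acts on the cohomology of the
  graded pieces of the complex by explicit integers, so that a correction can be moved to `F^(r-1)`;
  the corrections then add up to a genuine cocycle.
* If `z` exists, then `[z, -]` commutes with `d` up to sign and multiplies the leading term of a
  coderivation of degree `n` in `F^p` by `n + 1 - p`. It does so before and after applying `d`, and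
  `d_r` changes the multiplier by `1 - r ≠ 0`, so `d_r = 0` for `r ≥ 2`.
* The derivation `ν = z - (degree)` satisfies `[ν, Q] = -Q` and acts on `V^{⊙ n}` as `n` modulo
  fewer factors. The projections of `V^{⊙ n}` onto the eigenspaces of `ν` form an automorphism of
  the coalgebra `S(V)`, which carries the quadratic part of `Q` to `Q`, because `Q` lowers the
  eigenvalues of `ν` by exactly `1`.
  Conversely, an isomorphism from the quadratic part transports the cocycle `e` to such a `z`.
-/

namespace LInfinity

open scoped TensorProduct DirectSum

noncomputable section

theorem exists_intRec {X : ℤ → Type*} [∀ r, Inhabited (X r)] {k : ℤ} (x : X k)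
    (next : ∀ r, k ≤ r → X r → X (r + 1)) :
    ∃ ε : ∀ r, X r, ε k = x ∧ ∀ r hr, ε (r + 1) = next r hr (ε r) :=
  ⟨fun r => Int.inductionOn' r k x next fun _ _ _ => default,
    Int.inductionOn'_self .., fun _ _ => Int.inductionOn'_add_one ..⟩

namespace FilteredComplex

variable {K A : Type*} [Field K] [AddCommGroup A] [Module K A] (C : FilteredComplex K A)

theorem cls_surjective {p q r : ℤ} (x : C.E p q r) : ∃ z, ∃ hz : z ∈ C.Z p q r, C.cls z hz = x := by
  obtain ⟨⟨z, hz⟩, rfl⟩ := Submodule.Quotient.mk_surjective _ x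
  exact ⟨z, hz, rfl⟩

theorem dr_cls_eq_zero {p q r : ℤ} {x y : A} (hx : x ∈ C.Z p q r) (hy : y ∈ C.F (p + 1) (p + q))
    (h : C.d (p + q) y - C.d (p + q) x ∈ C.F (p + r + 1) (p + q + 1)) :
    C.dr p q r (C.cls x hx) = 0 := by
  have hdx : C.d (p + q) x ∈ C.F (p + r) (p + q + 1) := hx.2
  have hyZ : y ∈ C.Z (p + 1) (q - 1) (r - 1) := by
    rw [Z, show p + 1 + (q - 1) = p + q by ring, show p + 1 + (r - 1) = p + r by ring]
    exact ⟨hy, by simpa using add_mem (C.F_antitone _ _ _ (by omega) h) hdx⟩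
  have hxy : x - y ∈ C.Z p q (r + 1) := by
    refine ⟨sub_mem hx.1 (C.F_antitone _ _ _ (by omega) hy), ?_⟩
    simpa [← add_assoc] using neg_mem h
  refine (C.exists_isNext_iff _).1 ⟨C.cls _ hxy, x - y, hxy, C.cls_eq_cls.2 ?_, rfl⟩
  rw [sub_sub_cancel_left]
  exact Submodule.mem_sup_left (neg_mem hyZ)

variable {C}

theorem DegeneratesAt.allDifferentialsVanish {k : ℤ} (h : C.DegeneratesAt k) {p q : ℤ}
    (e : C.E p q k) : C.AllDifferentialsVanish e := by
  have hnext : ∀ r : ℤ, k ≤ r → ∀ x : C.E p q r, ∃ y, C.IsNext x y := fun r hr x =>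
    (C.exists_isNext_iff x).2 (by rw [h r hr, LinearMap.zero_apply])
  choose next hnext using hnext
  obtain ⟨ε, h0, hε⟩ := exists_intRec e next
  refine ⟨ε, h0, fun r hr => ⟨by rw [h r hr, LinearMap.zero_apply], ?_⟩⟩
  rw [hε r hr]
  exact hnext r hr _

theorem exists_sub_d_mem_of_mem_B {p q r : ℤ} {x : A} (hx : x ∈ C.B p q r) :
    ∃ c ∈ C.deg (p + q - 1), x - C.d (p + q - 1) c ∈ C.F (p + 1) (p + q) := by
  obtain ⟨a, ha, _, ⟨c, hc, rfl⟩, rfl⟩ := Submodule.mem_sup.1 hx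
  have hc' := C.F_le_deg _ _ hc.1
  have ha' := ha.1
  rw [show p - r + 1 + (q + r - 2) = p + q - 1 by ring] at hc' ⊢
  rw [show p + 1 + (q - 1) = p + q by ring] at ha'
  exact ⟨c, hc', by rwa [add_sub_cancel_right]⟩

theorem exists_sub_sub_d_mem_of_isNext {p q k : ℤ} {z : A} {hz : z ∈ C.Z p q k}
    {ε : ∀ r, C.E p q r} (h0 : ε k = C.cls z hz) (h : ∀ r, k ≤ r → C.IsNext (ε r) (ε (r + 1)))
    {r : ℤ} (hr : k ≤ r) {w : A} {hw : w ∈ C.Z p q r} (hwε : C.cls w hw = ε r) :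
    ∃ c ∈ C.deg (p + q - 1), w - z - C.d (p + q - 1) c ∈ C.F (p + 1) (p + q) := by
  induction r, hr using Int.leInduction generalizing w with
  | base => exact exists_sub_d_mem_of_mem_B (C.cls_eq_cls.1 (hwε.trans h0))
  | succ r hr ih =>
    obtain ⟨w', hw', hw'r, hw'ε⟩ := h r hr
    obtain ⟨c, hc, hwc⟩ := ih hw'r
    obtain ⟨b, hb, hwb⟩ := exists_sub_d_mem_of_mem_B (C.cls_eq_cls.1 (hwε.trans hw'ε.symm))
    refine ⟨b + c, add_mem hb hc, ?_⟩
    convert add_mem hwb hwc using 1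
    rw [map_add]
    abel

theorem AllDifferentialsVanish.exists_sub_mem {p q k : ℤ} {z : A} {hz : z ∈ C.Z p q k}
    (h : C.AllDifferentialsVanish (C.cls z hz)) {r : ℤ} (hr : k ≤ r) :
    ∃ u, u - z ∈ C.F (p + 1) (p + q) ∧ C.d (p + q) u ∈ C.F (p + r) (p + q + 1) := by
  obtain ⟨ε, h0, h⟩ := h
  obtain ⟨w, hw, hwε⟩ := C.cls_surjective (ε r)
  obtain ⟨c, hc, hwc⟩ := exists_sub_sub_d_mem_of_isNext h0 (fun r hr => (h r hr).2) hr hwε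
  have hdd := C.d_d _ _ hc
  rw [sub_add_cancel] at hdd
  refine ⟨w - C.d (p + q - 1) c, by rwa [sub_right_comm], ?_⟩
  rw [map_sub, hdd, sub_zero]
  exact hw.2

end FilteredComplex

section IndexOperator

variable {K W : Type*} [Field K] [AddCommGroup W] [Module K W]

/-- The operator `μ` acts as multiplication by `n` on the graded piece `M (n + 1) / M n` of the
increasing filtration `M`, which starts with `M 0 = 0`. -/
structure IsIndexOperator (M : ℕ → Submodule K W) (μ : Module.End K W) : Prop where
  zero : M 0 = ⊥
  mono : Monotone M
  sub_mem : ∀ n : ℕ, ∀ w ∈ M (n + 1), μ w - (n : K) • w ∈ M n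

/-- The binomial coefficient `μ (μ - 1) ⋯ (μ - n + 1) / n!` of an operator. For an index operator
`μ`, it maps `M (n + 1)` to the eigenspace of `μ` of eigenvalue `n`. -/
def binomialOperator (μ : Module.End K W) (n : ℕ) : Module.End K W :=
  (n.factorial : K)⁻¹ • Polynomial.aeval μ (descPochhammer K n)

theorem binomialOperator_zero (μ : Module.End K W) : binomialOperator μ 0 = 1 := by
  simp [binomialOperator]

theorem binomialOperator_mem {μ : Module.End K W} {U : Submodule K W} (hU : ∀ w ∈ U, μ w ∈ U)
    (n : ℕ) {w : W} (hw : w ∈ U) : binomialOperator μ n w ∈ U :=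
  U.smul_mem _ (Polynomial.aeval_apply_smul_mem_of_le_comap' hw _ μ hU)

namespace IsIndexOperator

variable {M : ℕ → Submodule K W} {μ : Module.End K W} (hμ : IsIndexOperator M μ)
include hμ

theorem apply_mem {n : ℕ} {w : W} (hw : w ∈ M n) : μ w ∈ M n := by
  cases n with
  | zero => simp_all [hμ.zero]
  | succ n =>
    simpa using add_mem (hμ.mono n.le_succ (hμ.sub_mem n w hw)) ((M _).smul_mem (n : K) hw)

theorem aeval_sub_eval_smul_mem (p : Polynomial K) {n : ℕ} {w : W} (hw : w ∈ M (n + 1)) :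
    Polynomial.aeval μ p w - p.eval (n : K) • w ∈ M n := by
  obtain ⟨q, hq⟩ := Polynomial.X_sub_C_dvd_sub_C_eval (a := (n : K)) (p := p)
  have hp : Polynomial.aeval μ p w - p.eval (n : K) • w =
      Polynomial.aeval μ q (μ w - (n : K) • w) := by
    simpa [mul_comm _ q, Algebra.algebraMap_eq_smul_one, Nat.cast_smul_eq_nsmul] using
      LinearMap.congr_fun (congrArg (Polynomial.aeval μ) hq) w
  rw [hp]
  exact Polynomial.aeval_apply_smul_mem_of_le_comap' (hμ.sub_mem n w hw) _ μ
    fun _ => hμ.apply_mem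

theorem aeval_descPochhammer_eq_zero {n : ℕ} {w : W} (hw : w ∈ M n) :
    Polynomial.aeval μ (descPochhammer K n) w = 0 := by
  induction n generalizing w with
  | zero => simp_all [hμ.zero]
  | succ n ih =>
    simpa [descPochhammer_succ_right, Nat.cast_smul_eq_nsmul] using ih (hμ.sub_mem n w hw)

theorem apply_binomialOperator {n : ℕ} {w : W} (hw : w ∈ M (n + 1)) :
    μ (binomialOperator μ n w) = (n : K) • binomialOperator μ n w := by
  have h := hμ.aeval_descPochhammer_eq_zero hw
  rw [descPochhammer_succ_right, mul_comm] at h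
  have h' : μ (Polynomial.aeval μ (descPochhammer K n) w) =
      (n : K) • Polynomial.aeval μ (descPochhammer K n) w := by
    simpa [sub_eq_zero, Nat.cast_smul_eq_nsmul] using h
  simp only [binomialOperator, LinearMap.smul_apply, map_smul, h']
  exact smul_comm ..

variable [CharZero K]

theorem binomialOperator_sub_mem {n : ℕ} {w : W} (hw : w ∈ M (n + 1)) :
    binomialOperator μ n w - w ∈ M n := by
  have hn : (n.factorial : K) ≠ 0 := Nat.cast_ne_zero.2 n.factorial_ne_zero
  have h := (M n).smul_mem (n.factorial : K)⁻¹
    (hμ.aeval_sub_eval_smul_mem (descPochhammer K n) hw)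
  rwa [descPochhammer_eval_eq_descFactorial, Nat.descFactorial_self, smul_sub,
    inv_smul_smul₀ hn] at h

theorem eq_zero_of_apply_eq_smul {n : ℕ} {w : W} (hw : w ∈ M n) (h : μ w = (n : K) • w) :
    w = 0 := by
  suffices key : ∀ m ≤ n, w ∈ M m → w = 0 from key n le_rfl hw
  intro m hm hwm
  induction m with
  | zero => simpa [hμ.zero] using hwm
  | succ m ih =>
    have hsub := hμ.sub_mem m w hwm
    rw [h, ← sub_smul] at hsub
    have hnm : (n : K) - m ≠ 0 := sub_ne_zero.2 (Nat.cast_injective.ne (by omega))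
    exact ih (by omega) ((Submodule.smul_mem_iff _ hnm).1 hsub)

theorem eq_of_apply_eq_smul {n : ℕ} {v w : W} (hv : μ v = (n : K) • v) (hw : μ w = (n : K) • w)
    (h : v - w ∈ M n) : v = w :=
  sub_eq_zero.1 (hμ.eq_zero_of_apply_eq_smul h (by rw [map_sub, hv, hw, smul_sub]))

end IsIndexOperator

theorem bijective_of_sub_mem_filtration {M : ℕ → Submodule K W} (h0 : M 0 = ⊥)
    (hM : ∀ w, ∃ n, w ∈ M n) {f : Module.End K W} (hf : ∀ n, ∀ w ∈ M (n + 1), f w - w ∈ M n) :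
    Function.Bijective f := by
  refine ⟨(injective_iff_map_eq_zero f).2 fun w hw => ?_, fun w => ?_⟩
  all_goals obtain ⟨n, hn⟩ := hM w
  · induction n with
    | zero => simpa [h0] using hn
    | succ n ih => exact ih (by simpa [hw] using hf n w hn)
  · induction n generalizing w with
    | zero => exact ⟨0, by simp_all⟩
    | succ n ih =>
      obtain ⟨v, hv⟩ := ih (f w - w) (hf n w hn)
      exact ⟨w - v, by rw [map_sub, hv, sub_sub_cancel]⟩

end IndexOperator

variable {K V : Type*} [Field K] [AddCommGroup V] [Module K V]

namespace SymCoalg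

section Filtration

variable (𝒱 : ℤ → Submodule K V)

/-- The subspace `⨁_{n < m} V^{⊙ n}` of `S(V)`. -/
def symBelow (m : ℤ) : Submodule K (SymCoalg 𝒱) :=
  ⨆ (n : ℕ) (_ : (n : ℤ) < m), symPow 𝒱 n

/-- The subspace `⨁_{i + j < m} V^{⊙ i} ⊗ V^{⊙ j}` of `S(V) ⊗ S(V)`. -/
def tensorBelow (m : ℤ) : Submodule K (SymCoalg 𝒱 ⊗[K] SymCoalg 𝒱) :=
  Submodule.span K {w | ∃ (i j : ℕ) (a b : SymCoalg 𝒱), a ∈ symPow 𝒱 i ∧ b ∈ symPow 𝒱 j ∧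
    (i + j : ℤ) < m ∧ a ⊗ₜ b = w}

variable {𝒱}

theorem symBelow_le_iff {m : ℤ} {p : Submodule K (SymCoalg 𝒱)} :
    symBelow 𝒱 m ≤ p ↔ ∀ n : ℕ, (n : ℤ) < m → symPow 𝒱 n ≤ p :=
  iSup₂_le_iff

theorem symPow_le_symBelow {n : ℕ} {m : ℤ} (h : (n : ℤ) < m) : symPow 𝒱 n ≤ symBelow 𝒱 m :=
  symBelow_le_iff.1 le_rfl n h

theorem symBelow_mono : Monotone (symBelow 𝒱) := fun _ _ h =>
  symBelow_le_iff.2 fun _ hn => symPow_le_symBelow (hn.trans_le h)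

theorem symBelow_zero : symBelow 𝒱 0 = ⊥ :=
  eq_bot_iff.2 (symBelow_le_iff.2 fun n hn => absurd hn (by omega))

theorem mem_vanishingBelow_iff {m : ℤ} {α : SymCoalg 𝒱 →ₗ[K] SymCoalg 𝒱} :
    α ∈ vanishingBelow 𝒱 m ↔ ∀ x ∈ symBelow 𝒱 m, α x = 0 :=
  (symBelow_le_iff (p := LinearMap.ker α)).symm

theorem vanishingBelow_antitone : Antitone (vanishingBelow 𝒱) :=
  fun _ _ h _ hα i hi => hα i (hi.trans_le h)

theorem tensorBelow_mono : Monotone (tensorBelow 𝒱) := fun _ _ h =>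
  Submodule.span_mono fun _ ⟨i, j, a, b, ha, hb, hij, hw⟩ =>
    ⟨i, j, a, b, ha, hb, hij.trans_le h, hw⟩

theorem tensorBelow_zero : tensorBelow 𝒱 0 = ⊥ := by
  rw [tensorBelow, Submodule.span_eq_bot]
  rintro _ ⟨i, j, a, b, -, -, hij, -⟩
  omega

theorem tmul_mem_tensorBelow {m n k : ℤ} {a b : SymCoalg 𝒱} (ha : a ∈ symBelow 𝒱 m)
    (hb : b ∈ symBelow 𝒱 n) (hk : m + n ≤ k + 1) : a ⊗ₜ b ∈ tensorBelow 𝒱 k := by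
  refine (symBelow_le_iff (p := (tensorBelow 𝒱 k).comap
    ((TensorProduct.mk K _ _).flip b))).2 (fun i hi a ha => ?_) ha
  refine (symBelow_le_iff (p := (tensorBelow 𝒱 k).comap
    (TensorProduct.mk K _ _ a))).2 (fun j hj b hb => ?_) hb
  exact Submodule.subset_span ⟨i, j, a, b, ha, hb, by omega, rfl⟩

theorem counit_of_mem_symPow {n : ℕ} (hn : n ≠ 0) {x : SymCoalg 𝒱} (hx : x ∈ symPow 𝒱 n) :
    counit 𝒱 x = 0 := by
  refine Submodule.span_le (p := LinearMap.ker (counit 𝒱).toLinearMap).2 ?_ hx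
  rintro _ ⟨m, d, hy, rfl⟩
  cases hy with
  | one => exact absurd rfl hn
  | ι_mul => simp

variable [DirectSum.Decomposition 𝒱]

theorem exists_mem_symBelow (x : SymCoalg 𝒱) : ∃ n : ℕ, x ∈ symBelow 𝒱 n := by
  induction x using DirectSum.Decomposition.inductionOn (symPow 𝒱) with
  | zero => exact ⟨0, zero_mem _⟩
  | add x y hx hy =>
    obtain ⟨m, hm⟩ := hx
    obtain ⟨n, hn⟩ := hy
    exact ⟨m + n, add_mem (symBelow_mono (by omega) hm) (symBelow_mono (by omega) hn)⟩
  | @homogeneous n x => exact ⟨n + 1, symPow_le_symBelow (by omega) x.2⟩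

theorem linearMap_ext_symPow {M : Type*} [AddCommGroup M] [Module K M]
    {α β : SymCoalg 𝒱 →ₗ[K] M} (h : ∀ n, ∀ x ∈ symPow 𝒱 n, α x = β x) : α = β := by
  ext x
  induction x using DirectSum.Decomposition.inductionOn (symPow 𝒱) with
  | zero => simp only [map_zero]
  | add x y hx hy => rw [map_add, hx, hy, map_add]
  | @homogeneous n x => exact h n x x.2

/-- The linear map on `S(V)` which acts on `V^{⊙ n}` as `f n`. -/
def ofSymPow {M : Type*} [AddCommGroup M] [Module K M] (f : ℕ → SymCoalg 𝒱 →ₗ[K] M) :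
    SymCoalg 𝒱 →ₗ[K] M :=
  DirectSum.toModule K ℕ M (fun n => f n ∘ₗ (symPow 𝒱 n).subtype) ∘ₗ
    (DirectSum.decomposeLinearEquiv (symPow 𝒱)).toLinearMap

theorem ofSymPow_apply {M : Type*} [AddCommGroup M] [Module K M]
    (f : ℕ → SymCoalg 𝒱 →ₗ[K] M) {n : ℕ} {x : SymCoalg 𝒱} (hx : x ∈ symPow 𝒱 n) :
    ofSymPow f x = f n x := by
  simp only [ofSymPow, LinearMap.comp_apply, LinearEquiv.coe_coe,
    DirectSum.decomposeLinearEquiv_apply]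
  rw [DirectSum.decompose_of_mem _ hx, ← DirectSum.lof_eq_of K, DirectSum.toModule_lof]
  rfl

theorem ι_mem_symPow (v : V) : ι 𝒱 v ∈ symPow 𝒱 1 := by
  induction v using DirectSum.Decomposition.inductionOn 𝒱 with
  | zero => simp only [map_zero, zero_mem]
  | add x y hx hy => rw [map_add]; exact add_mem hx hy
  | @homogeneous i v => exact (IsMonomial.ι 𝒱 v.2).mem_symPow 𝒱

theorem comul_mem_of_tmul_mem {n : ℕ} {x : SymCoalg 𝒱} (hx : x ∈ symPow 𝒱 n)
    {N : Submodule K (SymCoalg 𝒱 ⊗[K] SymCoalg 𝒱)}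
    (h : ∀ i j, i + j = n → ∀ a ∈ symPow 𝒱 i, ∀ b ∈ symPow 𝒱 j, a ⊗ₜ b ∈ N) :
    comul 𝒱 x ∈ N := by
  refine Submodule.span_le (p := N.comap (comul 𝒱)).2 ?_ hx
  rintro _ ⟨n, d, hy, rfl⟩
  refine Submodule.span_le (p := N).2 ?_ (comul_mem_tensorPart 𝒱 hy)
  rintro _ ⟨i, _, a, j, _, b, ha, hb, rfl, rfl, rfl⟩
  exact h i j rfl a (ha.mem_symPow 𝒱) b (hb.mem_symPow 𝒱)

theorem comul_mem_tensorBelow {m : ℤ} {x : SymCoalg 𝒱} (hx : x ∈ symBelow 𝒱 m) :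
    comul 𝒱 x ∈ tensorBelow 𝒱 m := by
  refine (symBelow_le_iff (p := (tensorBelow 𝒱 m).comap (comul 𝒱))).2 (fun n hn x hx => ?_) hx
  refine comul_mem_of_tmul_mem (N := tensorBelow 𝒱 m) hx fun i j hij a ha b hb => ?_
  exact Submodule.subset_span ⟨i, j, a, b, ha, hb, by omega, rfl⟩

theorem hat_mem_symBelow {q : SymCoalg 𝒱 →ₗ[K] V} {s : ℤ} (hq : ∀ x ∈ symBelow 𝒱 s, q x = 0)
    {m k : ℤ} {x : SymCoalg 𝒱} (hx : x ∈ symBelow 𝒱 m) (hk : m + 1 ≤ k + s) :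
    hat 𝒱 q x ∈ symBelow 𝒱 k := by
  refine Submodule.span_le (p := (symBelow 𝒱 k).comap (LinearMap.mul' K (SymCoalg 𝒱) ∘ₗ
    TensorProduct.map (ι 𝒱 ∘ₗ q) LinearMap.id)).2 ?_ (comul_mem_tensorBelow hx)
  rintro _ ⟨i, j, a, b, ha, hb, hij, rfl⟩
  change ι 𝒱 (q a) * b ∈ symBelow 𝒱 k
  by_cases hi : (i : ℤ) < s
  · rw [hq a (symPow_le_symBelow hi ha), map_zero, zero_mul]
    exact zero_mem _
  · exact symPow_le_symBelow (by omega) (SetLike.mul_mem_graded (ι_mem_symPow (q a)) hb)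

theorem hat_apply_symPow {q : SymCoalg 𝒱 →ₗ[K] V} {s : ℕ} (hq : ∀ x ∈ symBelow 𝒱 s, q x = 0)
    {x : SymCoalg 𝒱} (hx : x ∈ symPow 𝒱 s) : hat 𝒱 q x = ι 𝒱 (q x) := by
  have h : comul 𝒱 x ∈ LinearMap.eqLocus (LinearMap.mul' K (SymCoalg 𝒱) ∘ₗ
      TensorProduct.map (ι 𝒱 ∘ₗ q) LinearMap.id) (ι 𝒱 ∘ₗ q ∘ₗ
        (TensorProduct.rid K (SymCoalg 𝒱)).toLinearMap ∘ₗ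
        TensorProduct.map LinearMap.id (counit 𝒱).toLinearMap) := by
    refine comul_mem_of_tmul_mem hx fun i j hij a ha b hb => ?_
    change ι 𝒱 (q a) * b = ι 𝒱 (q (counit 𝒱 b • a))
    rcases eq_or_ne j 0 with rfl | hj
    · conv_lhs => rw [eq_counit_smul_one 𝒱 hb, mul_smul_comm, mul_one]
      rw [map_smul, map_smul]
    · rw [hq a (symPow_le_symBelow (by omega) ha), counit_of_mem_symPow hj hb]
      simp only [map_zero, zero_mul, zero_smul]
  simpa [counit_comul_right, hat] using h

end Filtration

section Coderivation

variable {𝒱 : ℤ → Submodule K V} [DirectSum.Decomposition 𝒱] {m n : ℤ}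
  {α β : SymCoalg 𝒱 →ₗ[K] SymCoalg 𝒱}

theorem IsCoderivation.add (hα : IsCoderivation 𝒱 n α) (hβ : IsCoderivation 𝒱 n β) :
    IsCoderivation 𝒱 n (α + β) :=
  (Coder 𝒱 n).add_mem hα hβ

theorem IsCoderivation.smul (c : K) (hα : IsCoderivation 𝒱 n α) : IsCoderivation 𝒱 n (c • α) :=
  (Coder 𝒱 n).smul_mem c hα

theorem IsCoderivation.comul_comp_comp (hα : IsCoderivation 𝒱 m α) (hβ : IsCoderivation 𝒱 n β) :
    comul 𝒱 ∘ₗ α ∘ₗ β =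
      (TensorProduct.map (α ∘ₗ β) LinearMap.id +
        sgn K (m * n) • TensorProduct.map (signMap 𝒱 n ∘ₗ α) β +
        TensorProduct.map (signMap 𝒱 m ∘ₗ β) α +
        TensorProduct.map (signMap 𝒱 (m + n)) (α ∘ₗ β)) ∘ₗ comul 𝒱 := by
  rw [← LinearMap.comp_assoc, hα.comul_comp, LinearMap.comp_assoc, hβ.comul_comp,
    ← LinearMap.comp_assoc, signMap_comp 𝒱 hα.hasDegree, ← signMap_comp_signMap]
  congr 1
  simp only [LinearMap.add_comp, LinearMap.comp_add, ← TensorProduct.map_comp, LinearMap.id_comp,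
    LinearMap.comp_id, TensorProduct.map_smul_left, smul_smul, mul_comm n m, sgn_mul_self, one_smul]
  abel

theorem IsCoderivation.gradedCommutator (hα : IsCoderivation 𝒱 m α) (hβ : IsCoderivation 𝒱 n β) :
    IsCoderivation 𝒱 (m + n) (α ∘ₗ β - sgn K (m * n) • (β ∘ₗ α)) where
  hasDegree d x hx := by
    have hαβ := HasDegree.comp 𝒱 hα.hasDegree hβ.hasDegree d x hx
    rw [add_comm n m] at hαβ
    exact sub_mem hαβ
      (Submodule.smul_mem _ _ (HasDegree.comp 𝒱 hβ.hasDegree hα.hasDegree d x hx))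
  comul_comp := by
    rw [LinearMap.comp_sub, LinearMap.comp_smul, hα.comul_comp_comp hβ, hβ.comul_comp_comp hα,
      ← LinearMap.smul_comp, ← LinearMap.sub_comp]
    congr 1
    simp only [smul_add, smul_smul, mul_comm n m, add_comm n m, sgn_mul_self, one_smul,
      map_sub_left, map_sub_right, TensorProduct.map_smul_left, TensorProduct.map_smul_right]
    abel

theorem IsCoderivation.lie (hα : IsCoderivation 𝒱 0 α) (hβ : IsCoderivation 𝒱 n β) :
    IsCoderivation 𝒱 n ⁅α, β⁆ := by
  have h := hα.gradedCommutator hβ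
  rwa [zero_add, zero_mul, sgn_zero, one_smul] at h

theorem exists_forall_sub_mem_vanishingBelow {z : ℕ → SymCoalg 𝒱 →ₗ[K] SymCoalg 𝒱}
    (h : ∀ i : ℕ, z (i + 1) - z i ∈ vanishingBelow 𝒱 i) :
    ∃ w, ∀ i : ℕ, w - z i ∈ vanishingBelow 𝒱 i := by
  have hij : ∀ i j : ℕ, i ≤ j → z j - z i ∈ vanishingBelow 𝒱 i := fun i j hj => by
    induction j, hj using Nat.le_induction with
    | base => simp only [sub_self, zero_mem]
    | succ j hj ih =>
      simpa only [sub_add_sub_cancel] using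
        add_mem (vanishingBelow_antitone (by omega) (h j)) ih
  refine ⟨ofSymPow fun i => z (i + 1), fun i j hj x hx => ?_⟩
  rw [LinearMap.sub_apply, ofSymPow_apply _ hx, sub_eq_zero, eq_comm, ← sub_eq_zero]
  exact hij (j + 1) i (by omega) j (by omega) x hx

theorem isCoderivation_of_forall_sub_mem_vanishingBelow
    (h : ∀ i : ℕ, ∃ β, IsCoderivation 𝒱 n β ∧ α - β ∈ vanishingBelow 𝒱 i) :
    IsCoderivation 𝒱 n α where
  hasDegree d x hx := by
    refine Submodule.span_le (p := (degPart 𝒱 (d + n)).comap α).2 ?_ hx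
    rintro y ⟨k, d, hy, rfl⟩
    obtain ⟨β, hβ, hαβ⟩ := h (k + 1)
    have heq : α y = β y := sub_eq_zero.1 (hαβ k (by omega) y (hy.mem_symPow 𝒱))
    rw [SetLike.mem_coe, Submodule.mem_comap]
    change α y ∈ degPart 𝒱 (d + n)
    rw [heq]
    exact hβ.hasDegree _ _ (hy.mem_degPart 𝒱)
  comul_comp := linearMap_ext_symPow fun k x hx => by
    obtain ⟨β, hβ, hαβ⟩ := h (k + 1)
    have heq : ∀ i ≤ k, ∀ y ∈ symPow 𝒱 i, β y = α y := fun i hi y hy =>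
      (sub_eq_zero.1 (hαβ i (by omega) y hy)).symm
    rw [LinearMap.comp_apply, ← heq k le_rfl x hx]
    refine (LinearMap.congr_fun hβ.comul_comp x).trans ?_
    refine comul_mem_of_tmul_mem (N := LinearMap.eqLocus (_ + _) (_ + _)) hx
      fun i j hij a ha b hb => ?_
    simp only [LinearMap.mem_eqLocus, LinearMap.add_apply, TensorProduct.map_tmul,
      heq i (by omega) a ha, heq j (by omega) b hb]

variable [CharZero K]

theorem IsCoderivation.apply_mem_symBelow (hα : IsCoderivation 𝒱 n α) {s : ℤ}
    (hs : α ∈ vanishingBelow 𝒱 s) {k l : ℤ} {x : SymCoalg 𝒱} (hx : x ∈ symBelow 𝒱 k)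
    (hkl : k + 1 ≤ l + s) : α x ∈ symBelow 𝒱 l := by
  rw [hα.eq_hat 𝒱]
  refine hat_mem_symBelow (fun y hy => ?_) hx hkl
  rw [LinearMap.comp_apply, mem_vanishingBelow_iff.1 hs y hy, map_zero]

theorem IsCoderivation.apply_eq_ι (hα : IsCoderivation 𝒱 n α) {s : ℕ}
    (hs : α ∈ vanishingBelow 𝒱 s) {x : SymCoalg 𝒱} (hx : x ∈ symPow 𝒱 s) :
    α x = ι 𝒱 (proj 𝒱 (α x)) := by
  conv_lhs => rw [hα.eq_hat 𝒱]
  refine hat_apply_symPow (fun y hy => ?_) hx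
  rw [LinearMap.comp_apply, mem_vanishingBelow_iff.1 hs y hy, map_zero]

theorem mul_mem_vanishingBelow {i j k : ℤ} (hα : α ∈ vanishingBelow 𝒱 i)
    (hβ : IsCoderivation 𝒱 n β) (hβj : β ∈ vanishingBelow 𝒱 j) (hk : k + 1 ≤ i + j) :
    α * β ∈ vanishingBelow 𝒱 k :=
  mem_vanishingBelow_iff.2 fun _ hx =>
    mem_vanishingBelow_iff.1 hα _ (hβ.apply_mem_symBelow hβj hx (by omega))

theorem IsCoderivation.lie_mem_vanishingBelow (hα : IsCoderivation 𝒱 m α)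
    (hβ : IsCoderivation 𝒱 n β) {i j k : ℤ} (hαi : α ∈ vanishingBelow 𝒱 i)
    (hβj : β ∈ vanishingBelow 𝒱 j) (hk : k + 1 ≤ i + j) : ⁅α, β⁆ ∈ vanishingBelow 𝒱 k :=
  sub_mem (mul_mem_vanishingBelow hαi hβ hβj hk)
    (mul_mem_vanishingBelow hβj hα hαi (by omega))

theorem IsCoderivation.mem_vanishingBelow (hα : IsCoderivation 𝒱 n α) {p : ℤ}
    (h : ∀ k : ℕ, (k : ℤ) < p → ∀ x ∈ symPow 𝒱 k, proj 𝒱 (α x) = 0) :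
    α ∈ vanishingBelow 𝒱 p := fun k hk =>
  hα.eq_zero 𝒱 (k + 1) (fun j hj => h j (by omega)) k k.lt_succ_self

theorem IsCoderivation.counit_apply (hα : IsCoderivation 𝒱 n α) (x : SymCoalg 𝒱) :
    counit 𝒱 (α x) = 0 := by
  rw [hα.eq_hat 𝒱, hat, LinearMap.comp_apply, LinearMap.comp_apply]
  induction comul 𝒱 x using TensorProduct.induction_on with
  | zero => simp only [map_zero]
  | add x y hx hy => rw [map_add, map_add, map_add, hx, hy, add_zero]
  | tmul a b => simp

end Coderivation

section Euler

variable (𝒱 : ℤ → Submodule K V) [DirectSum.Decomposition 𝒱]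

theorem isCoderivation_hat_proj : IsCoderivation 𝒱 0 (hat 𝒱 (proj 𝒱)) :=
  isCoderivation_hat 𝒱 fun d x hx => by rw [add_zero]; exact proj_mem 𝒱 hx

theorem isCoderivation_eulerDerivation : IsCoderivation 𝒱 0 (eulerDerivation 𝒱) := by
  refine isCoderivation_hat 𝒱 fun d x hx => ?_
  rw [LinearMap.comp_apply, eulerMap_apply 𝒱 (proj_mem 𝒱 hx), add_zero]
  exact Submodule.smul_mem _ _ (proj_mem 𝒱 hx)

/-- The coderivation of `S(V)` which multiplies by the internal degree. The Euler derivation is the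
sum of it and of `hat proj`, which multiplies by the symmetric degree. -/
def degreeDerivation : SymCoalg 𝒱 →ₗ[K] SymCoalg 𝒱 :=
  eulerDerivation 𝒱 - hat 𝒱 (proj 𝒱)

variable {𝒱}

theorem IsMonomial.eulerDerivation_apply {n : ℕ} {d : ℤ} {y : SymCoalg 𝒱}
    (hy : IsMonomial 𝒱 n d y) : eulerDerivation 𝒱 y = (n + d : K) • y :=
  hat_comp_proj_monomial 𝒱 (c := fun i => (i : K) + 1) (w := fun n d => (n : K) + d)
    (fun _ _ hv => eulerMap_apply 𝒱 hv) (by simp) (by intro n i d; push_cast; ring) hy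

theorem degreeDerivation_apply {d : ℤ} {x : SymCoalg 𝒱} (hx : x ∈ degPart 𝒱 d) :
    degreeDerivation 𝒱 x = (d : K) • x := by
  refine Submodule.span_le (p := LinearMap.eqLocus (degreeDerivation 𝒱)
    ((d : K) • LinearMap.id)).2 ?_ hx
  rintro y ⟨n, d, hy, rfl⟩
  rw [SetLike.mem_coe, LinearMap.mem_eqLocus, degreeDerivation, LinearMap.sub_apply,
    hy.eulerDerivation_apply,
    hat_proj_symPow 𝒱 (hy.mem_symPow 𝒱), ← sub_smul, add_sub_cancel_left]
  rfl

theorem HasDegree.degreeDerivation_lie {n : ℤ} {α : SymCoalg 𝒱 →ₗ[K] SymCoalg 𝒱}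
    (hα : HasDegree (degPart 𝒱) (degPart 𝒱) n α) : ⁅degreeDerivation 𝒱, α⁆ = (n : K) • α := by
  ext x
  induction x using DirectSum.Decomposition.inductionOn (degPart 𝒱) with
  | zero => simp only [map_zero]
  | add x y hx hy => rw [map_add, hx, hy, map_add]
  | @homogeneous d x =>
    rw [Ring.lie_def, LinearMap.sub_apply, Module.End.mul_apply,
      Module.End.mul_apply, degreeDerivation_apply (hα d x x.2), degreeDerivation_apply x.2,
      map_smul, ← sub_smul, LinearMap.smul_apply]
    push_cast
    rw [add_sub_cancel_left]

variable [CharZero K]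

theorem IsCoderivation.hat_proj_lie_sub_smul_mem_vanishingBelow {n s : ℤ}
    {α : SymCoalg 𝒱 →ₗ[K] SymCoalg 𝒱} (hα : IsCoderivation 𝒱 n α) (hs : α ∈ vanishingBelow 𝒱 s) :
    ⁅hat 𝒱 (proj 𝒱), α⁆ - (1 - s : K) • α ∈ vanishingBelow 𝒱 (s + 1) := by
  intro k hk x hx
  have hcomm : ⁅hat 𝒱 (proj 𝒱), α⁆ x = hat 𝒱 (proj 𝒱) (α x) - (k : K) • α x := by
    rw [Ring.lie_def, LinearMap.sub_apply, Module.End.mul_apply, Module.End.mul_apply,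
      hat_proj_symPow 𝒱 hx, map_smul]
  rw [LinearMap.sub_apply, hcomm, LinearMap.smul_apply]
  rcases (Int.lt_add_one_iff.1 hk).lt_or_eq with hks | rfl
  · simp [hs k hks x hx]
  · have hαx : α x ∈ symPow 𝒱 1 := by
      rw [hα.apply_eq_ι hs hx]
      exact ι_mem_symPow _
    rw [hat_proj_symPow 𝒱 hαx, ← sub_smul, Nat.cast_one, Int.cast_natCast, sub_self]

theorem IsCoderivation.lie_sub_smul_mem_vanishingBelow {z α : SymCoalg 𝒱 →ₗ[K] SymCoalg 𝒱}
    {n s : ℤ} (hz : IsCoderivation 𝒱 0 z) (hze : z - eulerDerivation 𝒱 ∈ vanishingBelow 𝒱 2)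
    (hα : IsCoderivation 𝒱 n α) (hs : α ∈ vanishingBelow 𝒱 s) :
    ⁅z, α⁆ - (n + 1 - s : K) • α ∈ vanishingBelow 𝒱 (s + 1) := by
  have hsymm := hα.hat_proj_lie_sub_smul_mem_vanishingBelow hs
  have hrest := (hz.sub 𝒱 (isCoderivation_eulerDerivation 𝒱)).lie_mem_vanishingBelow hα hze hs
    (k := s + 1) (by omega)
  have hdeg := hα.hasDegree.degreeDerivation_lie
  have hsum : ⁅z, α⁆ = (n : K) • α + ⁅hat 𝒱 (proj 𝒱), α⁆ + ⁅z - eulerDerivation 𝒱, α⁆ := by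
    rw [← hdeg, degreeDerivation]
    simp only [Ring.lie_def, sub_mul, mul_sub]
    abel
  convert add_mem hsymm hrest using 1
  rw [hsum]
  module

end Euler

end SymCoalg

namespace LInfinityOneAlgebra

open SymCoalg

section EulerCocycle

variable {𝒱 : ℤ → Submodule K V} [DirectSum.Decomposition 𝒱] (L : LInfinityOneAlgebra 𝒱)
  [CharZero K]

/-- A coderivation of degree `0` which agrees with the Euler derivation modulo `F^2` and is a
cocycle of the Chevalley–Eilenberg complex modulo `F^r`. -/
structure IsEulerCocycleMod (r : ℤ) (z : SymCoalg 𝒱 →ₗ[K] SymCoalg 𝒱) : Prop where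
  isCoderivation : IsCoderivation 𝒱 0 z
  sub_euler_mem : z - eulerDerivation 𝒱 ∈ vanishingBelow 𝒱 2
  d_mem : L.CE.d 0 z ∈ vanishingBelow 𝒱 r

/-- The Euler derivation can be corrected by an element of `F^2` to a cocycle of the
Chevalley–Eilenberg complex. -/
def HasEulerCocycle : Prop :=
  ∃ z, IsCoderivation 𝒱 0 z ∧ z - eulerDerivation 𝒱 ∈ vanishingBelow 𝒱 2 ∧ L.CE.d 0 z = 0

theorem CE_d_apply (n : ℤ) (α : SymCoalg 𝒱 →ₗ[K] SymCoalg 𝒱) :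
    L.CE.d n α = L.Q * α - sgn K n • (α * L.Q) := rfl

theorem CE_d_zero_apply (α : SymCoalg 𝒱 →ₗ[K] SymCoalg 𝒱) : L.CE.d 0 α = ⁅L.Q, α⁆ := by
  rw [CE_d_apply, sgn_zero, one_smul, Ring.lie_def]

theorem CE_d_lie (n : ℤ) (z α : SymCoalg 𝒱 →ₗ[K] SymCoalg 𝒱) :
    L.CE.d n ⁅z, α⁆ =
      ⁅z, L.CE.d n α⁆ + (L.CE.d 0 z * α - sgn K n • (α * L.CE.d 0 z)) := by
  simp only [CE_d_apply, sgn_zero, one_smul, Ring.lie_def, mul_sub, sub_mul, smul_sub,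
    mul_smul_comm, smul_mul_assoc, mul_assoc]
  abel

variable {L}

theorem IsEulerCocycleMod.exists_d_sub_d_mem {p n r : ℤ} (hr : r ≠ 1)
    {z x : SymCoalg 𝒱 →ₗ[K] SymCoalg 𝒱} (hz : L.IsEulerCocycleMod (r + 2) z)
    (hx : x ∈ L.CE.F p n) (hdx : L.CE.d n x ∈ L.CE.F (p + r) (n + 1)) :
    ∃ y ∈ L.CE.F (p + 1) n, L.CE.d n y - L.CE.d n x ∈ L.CE.F (p + r + 1) (n + 1) := by
  have hr' : (1 - r : K) ≠ 0 := sub_ne_zero.2 (mod_cast hr.symm)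
  set y := ⁅z, x⁆ - (n + 1 - p : K) • x with hy
  have hyF : y ∈ L.CE.F (p + 1) n :=
    ⟨(hz.isCoderivation.lie hx.1).sub 𝒱 (hx.1.smul _),
      hz.isCoderivation.lie_sub_smul_mem_vanishingBelow hz.sub_euler_mem hx.1 hx.2⟩
  have hz_dx : ⁅z, L.CE.d n x⁆ - (n + 2 - (p + r) : K) • L.CE.d n x ∈
      vanishingBelow 𝒱 (p + r + 1) := by
    convert hz.isCoderivation.lie_sub_smul_mem_vanishingBelow hz.sub_euler_mem hdx.1 hdx.2 using 3
    push_cast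
    ring
  have hdz_x : L.CE.d 0 z * x - sgn K n • (x * L.CE.d 0 z) ∈ vanishingBelow 𝒱 (p + r + 1) :=
    sub_mem (mul_mem_vanishingBelow hz.d_mem hx.1 hx.2 (by omega)) (Submodule.smul_mem _ _
      (mul_mem_vanishingBelow hx.2 (L.CE.d_mem_deg 0 z hz.isCoderivation) hz.d_mem (by omega)))
  have hdy : L.CE.d n y - (1 - r : K) • L.CE.d n x ∈ vanishingBelow 𝒱 (p + r + 1) := by
    convert add_mem hz_dx hdz_x using 1
    rw [hy, map_sub, map_smul, CE_d_lie]
    module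
  refine ⟨(1 - r : K)⁻¹ • y, Submodule.smul_mem _ _ hyF,
    (L.CE.d_mem_deg n _ (hyF.1.smul _)).sub 𝒱 hdx.1, ?_⟩
  have h := Submodule.smul_mem _ (1 - r : K)⁻¹ hdy
  rwa [smul_sub, inv_smul_smul₀ hr', ← map_smul] at h

theorem HasEulerCocycle.degeneratesAt_two (h : L.HasEulerCocycle) : L.CE.DegeneratesAt 2 := by
  obtain ⟨z, hz, hze, hdz⟩ := h
  refine fun r hr p q => LinearMap.ext fun e => ?_
  obtain ⟨x, hx, rfl⟩ := L.CE.cls_surjective e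
  have hzr : L.IsEulerCocycleMod (r + 2) z := ⟨hz, hze, by rw [hdz]; exact zero_mem _⟩
  obtain ⟨y, hy, hdy⟩ := hzr.exists_d_sub_d_mem (by omega) hx.1 hx.2
  exact L.CE.dr_cls_eq_zero hx hy hdy

theorem IsEulerCocycleMod.exists_mem_F_d_sub_d_mem {r s : ℤ} (hs : 2 ≤ s) (hsr : s ≤ r)
    {z u : SymCoalg 𝒱 →ₗ[K] SymCoalg 𝒱} (hz : L.IsEulerCocycleMod (r + 1) z)
    (hu : u ∈ L.CE.F 2 0) (hdu : L.CE.d 0 u ∈ L.CE.F (r + 1) 1) :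
    ∃ y ∈ L.CE.F s 0, L.CE.d 0 y - L.CE.d 0 u ∈ L.CE.F (r + 2) 1 := by
  induction s, hs using Int.leInduction with
  | base => exact ⟨u, hu, by rw [sub_self]; exact zero_mem _⟩
  | succ s hs ih =>
    obtain ⟨y, hy, hyu⟩ := ih (by omega)
    have hz' : L.IsEulerCocycleMod (r + 1 - s + 2) z :=
      ⟨hz.isCoderivation, hz.sub_euler_mem, vanishingBelow_antitone (by omega) hz.d_mem⟩
    have hdy : L.CE.d 0 y ∈ L.CE.F (s + (r + 1 - s)) 1 := by
      rw [add_sub_cancel]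
      simpa only [sub_add_cancel] using add_mem (L.CE.F_antitone _ _ _ (by omega) hyu) hdu
    obtain ⟨y', hy', hyy'⟩ := hz'.exists_d_sub_d_mem (by omega) hy hdy
    rw [show s + (r + 1 - s) + 1 = r + 2 by ring] at hyy'
    exact ⟨y', hy', by simpa only [sub_add_sub_cancel, zero_add] using add_mem hyy' hyu⟩

theorem IsEulerCocycleMod.exists_succ {r : ℤ} (hr : 2 ≤ r) {z u : SymCoalg 𝒱 →ₗ[K] SymCoalg 𝒱}
    (hz : L.IsEulerCocycleMod (r + 1) z) (hu : L.IsEulerCocycleMod (r + 2) u) :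
    ∃ z', L.IsEulerCocycleMod (r + 2) z' ∧ z' - z ∈ vanishingBelow 𝒱 r := by
  have hx : IsCoderivation 𝒱 0 (u - z) := hu.isCoderivation.sub 𝒱 hz.isCoderivation
  have hx2 : u - z ∈ vanishingBelow 𝒱 2 := by
    simpa only [sub_sub_sub_cancel_right] using sub_mem hu.sub_euler_mem hz.sub_euler_mem
  have hdx : L.CE.d 0 (u - z) ∈ vanishingBelow 𝒱 (r + 1) := by
    rw [map_sub]
    exact sub_mem (vanishingBelow_antitone (by omega) hu.d_mem) hz.d_mem
  obtain ⟨y, hy, hdy⟩ := hz.exists_mem_F_d_sub_d_mem hr le_rfl ⟨hx, hx2⟩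
    ⟨L.CE.d_mem_deg 0 _ hx, hdx⟩
  refine ⟨z + y, ⟨hz.isCoderivation.add hy.1, ?_, ?_⟩, by rw [add_sub_cancel_left]; exact hy.2⟩
  · rw [add_sub_right_comm]
    exact add_mem hz.sub_euler_mem (vanishingBelow_antitone hr hy.2)
  · convert add_mem hdy.2 hu.d_mem using 1
    rw [map_sub, map_add]
    abel

theorem Q_mem_vanishingBelow_two (hL : L.IsMinimal) : L.Q ∈ vanishingBelow 𝒱 2 := by
  refine L.isCoderivation.mem_vanishingBelow fun k hk x hx => ?_
  obtain rfl | rfl : k = 0 ∨ k = 1 := by omega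
  · exact L.proj_Q_zero hx
  · rw [← L.bracket_apply hx, show L.bracket 1 = 0 from hL, LinearMap.zero_apply]

theorem exists_seq_isEulerCocycleMod (hL : L.IsMinimal)
    (h : ∀ r, 2 ≤ r → ∃ u, L.IsEulerCocycleMod (r + 1) u) :
    ∃ z : ℕ → SymCoalg 𝒱 →ₗ[K] SymCoalg 𝒱, (∀ i : ℕ, L.IsEulerCocycleMod (i + 3) (z i)) ∧
      ∀ i : ℕ, z (i + 1) - z i ∈ vanishingBelow 𝒱 i := by
  have step : ∀ (i : ℕ) (z : {z // L.IsEulerCocycleMod (i + 3) z}),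
      ∃ z' : {z // L.IsEulerCocycleMod ((i + 1 : ℕ) + 3) z},
        (z' - z : SymCoalg 𝒱 →ₗ[K] SymCoalg 𝒱) ∈ vanishingBelow 𝒱 i := by
    rintro i ⟨z, hz⟩
    obtain ⟨u, hu⟩ := h (i + 3) (by omega)
    obtain ⟨z', hz', hzz'⟩ := IsEulerCocycleMod.exists_succ (r := i + 2) (z := z) (u := u)
      (by omega) (by rwa [add_assoc]) (by rwa [add_assoc] at hu ⊢)
    refine ⟨⟨z', ?_⟩, vanishingBelow_antitone (by omega) hzz'⟩
    rwa [show ((i + 1 : ℕ) : ℤ) + 3 = i + 2 + 2 by push_cast; ring]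
  choose next hnext using step
  have he : L.IsEulerCocycleMod ((0 : ℕ) + 3) (eulerDerivation 𝒱) :=
    ⟨isCoderivation_eulerDerivation 𝒱, by rw [sub_self]; exact zero_mem _,
      (L.eulerDerivation_mem_Z hL).2.2⟩
  let z : ∀ i : ℕ, {z // L.IsEulerCocycleMod (i + 3) z} := fun i => Nat.rec ⟨_, he⟩ next i
  exact ⟨fun i => (z i).1, fun i => (z i).2, fun i => hnext i (z i)⟩

theorem hasEulerCocycle_of_forall_isEulerCocycleMod (hL : L.IsMinimal)
    (h : ∀ r, 2 ≤ r → ∃ u, L.IsEulerCocycleMod (r + 1) u) : L.HasEulerCocycle := by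
  obtain ⟨z, hz, hzz⟩ := exists_seq_isEulerCocycleMod hL h
  obtain ⟨w, hw⟩ := exists_forall_sub_mem_vanishingBelow hzz
  have hwc : IsCoderivation 𝒱 0 w := isCoderivation_of_forall_sub_mem_vanishingBelow fun i =>
    ⟨z i, (hz i).isCoderivation, hw i⟩
  refine ⟨w, hwc, ?_, linearMap_ext_symPow fun n x hx => ?_⟩
  · simpa only [sub_add_sub_cancel, Nat.cast_ofNat] using add_mem (hw 2) (hz 2).sub_euler_mem
  · have hdw : L.CE.d 0 (w - z (n + 1)) ∈ vanishingBelow 𝒱 (n + 1) :=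
      (L.CE.d_mem_F (n + 1) 0 _ ⟨hwc.sub 𝒱 (hz _).isCoderivation, hw (n + 1)⟩).2
    have hd := add_mem hdw (vanishingBelow_antitone (by omega) (hz (n + 1)).d_mem)
    rw [map_sub, sub_add_cancel] at hd
    exact hd n (by omega) x hx

theorem hasEulerCocycle_of_allDifferentialsVanish (hL : L.IsMinimal)
    (h : L.CE.AllDifferentialsVanish (L.eulerClass hL)) : L.HasEulerCocycle := by
  refine hasEulerCocycle_of_forall_isEulerCocycleMod hL fun r hr => ?_
  obtain ⟨u, hu, hdu⟩ := h.exists_sub_mem hr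
  refine ⟨u, ?_, hu.2, ?_⟩
  · have hc : IsCoderivation 𝒱 0 (u - eulerDerivation 𝒱) := hu.1
    simpa only [sub_add_cancel] using hc.add (isCoderivation_eulerDerivation 𝒱)
  · rw [add_comm r 1]
    exact hdu.2

end EulerCocycle

end LInfinityOneAlgebra

namespace SymCoalg

section Straighten

variable {𝒱 : ℤ → Submodule K V}

/-- The operator `ν ⊗ 1 + 1 ⊗ ν` on `S(V) ⊗ S(V)`. -/
def leibniz (ν : Module.End K (SymCoalg 𝒱)) : Module.End K (SymCoalg 𝒱 ⊗[K] SymCoalg 𝒱) :=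
  TensorProduct.map ν LinearMap.id + TensorProduct.map LinearMap.id ν

theorem leibniz_tmul (ν : Module.End K (SymCoalg 𝒱)) (a b : SymCoalg 𝒱) :
    leibniz ν (a ⊗ₜ b) = ν a ⊗ₜ b + a ⊗ₜ ν b := rfl

theorem isIndexOperator_leibniz {ν : Module.End K (SymCoalg 𝒱)}
    (hν : IsIndexOperator (fun n : ℕ => symBelow 𝒱 n) ν) :
    IsIndexOperator (fun n : ℕ => tensorBelow 𝒱 n) (leibniz ν) where
  zero := tensorBelow_zero
  mono _ _ h := tensorBelow_mono (Nat.cast_le.2 h)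
  sub_mem n w hw := by
    refine Submodule.span_le (p := (tensorBelow 𝒱 n).comap
      (leibniz ν - (n : K) • LinearMap.id)).2 ?_ hw
    rintro _ ⟨i, j, a, b, ha, hb, hij, rfl⟩
    have ha' : a ∈ symBelow 𝒱 (i + 1 : ℕ) := symPow_le_symBelow (by omega) ha
    have hb' : b ∈ symBelow 𝒱 (j + 1 : ℕ) := symPow_le_symBelow (by omega) hb
    have hleft : (ν a - (i : K) • a) ⊗ₜ[K] b ∈ tensorBelow 𝒱 n :=
      tmul_mem_tensorBelow (hν.sub_mem i a ha') hb' (by omega)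
    have hright : a ⊗ₜ[K] (ν b - (j : K) • b) ∈ tensorBelow 𝒱 n :=
      tmul_mem_tensorBelow ha' (hν.sub_mem j b hb') (by omega)
    have hscalar : ((i + j : ℕ) - n : K) • a ⊗ₜ[K] b ∈ tensorBelow 𝒱 n := by
      obtain h | rfl : i + j < n ∨ i + j = n := by omega
      · exact Submodule.smul_mem _ _ (tmul_mem_tensorBelow ha' hb' (by omega))
      · rw [sub_self, zero_smul]
        exact zero_mem _
    rw [SetLike.mem_coe, Submodule.mem_comap]
    convert add_mem (add_mem hleft hright) hscalar using 1
    simp only [LinearMap.sub_apply, leibniz_tmul, LinearMap.id_apply, LinearMap.smul_apply,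
      TensorProduct.sub_tmul, TensorProduct.tmul_sub, TensorProduct.tmul_smul,
      ← TensorProduct.smul_tmul', Nat.cast_add]
    module

variable [DirectSum.Decomposition 𝒱]

theorem signMap_zero : signMap 𝒱 0 = LinearMap.id := by
  ext x
  induction x using DirectSum.Decomposition.inductionOn (degPart 𝒱) with
  | zero => simp only [map_zero]
  | add x y hx hy => rw [map_add, hx, hy, map_add]
  | @homogeneous n x => simp [signMap_apply 𝒱 0 x.2]

theorem IsCoderivation.comul_apply_eq_leibniz {α : SymCoalg 𝒱 →ₗ[K] SymCoalg 𝒱}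
    (hα : IsCoderivation 𝒱 0 α) (x : SymCoalg 𝒱) : comul 𝒱 (α x) = leibniz α (comul 𝒱 x) := by
  have h := LinearMap.congr_fun hα.comul_comp x
  rwa [signMap_zero] at h

/-- The linear map on `S(V)` which acts on `V^{⊙ n}` as the binomial coefficient of `ν` of order
`n`. -/
def straighten (ν : Module.End K (SymCoalg 𝒱)) : Module.End K (SymCoalg 𝒱) :=
  ofSymPow (binomialOperator ν)

theorem straighten_apply (ν : Module.End K (SymCoalg 𝒱)) {n : ℕ} {x : SymCoalg 𝒱}
    (hx : x ∈ symPow 𝒱 n) : straighten ν x = binomialOperator ν n x :=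
  ofSymPow_apply _ hx

theorem hasDegree_straighten {ν : SymCoalg 𝒱 →ₗ[K] SymCoalg 𝒱}
    (hν : HasDegree (degPart 𝒱) (degPart 𝒱) 0 ν) :
    HasDegree (degPart 𝒱) (degPart 𝒱) 0 (straighten ν) := by
  intro d x hx
  simp only [HasDegree, add_zero] at hν ⊢
  refine Submodule.span_le (p := (degPart 𝒱 d).comap (straighten ν)).2 ?_ hx
  rintro y ⟨n, d, hy, rfl⟩
  rw [SetLike.mem_coe, Submodule.mem_comap, straighten_apply ν (hy.mem_symPow 𝒱)]
  exact binomialOperator_mem (hν d) n (hy.mem_degPart 𝒱)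

variable {ν : SymCoalg 𝒱 →ₗ[K] SymCoalg 𝒱}

theorem apply_straighten (hν : IsIndexOperator (fun n : ℕ => symBelow 𝒱 n) ν) {n : ℕ}
    {x : SymCoalg 𝒱} (hx : x ∈ symPow 𝒱 n) : ν (straighten ν x) = (n : K) • straighten ν x := by
  rw [straighten_apply ν hx]
  exact hν.apply_binomialOperator (symPow_le_symBelow (by omega) hx)

variable [CharZero K]

theorem straighten_sub_mem (hν : IsIndexOperator (fun n : ℕ => symBelow 𝒱 n) ν) (n : ℕ)
    {x : SymCoalg 𝒱} (hx : x ∈ symBelow 𝒱 (n + 1 : ℕ)) : straighten ν x - x ∈ symBelow 𝒱 n := by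
  refine (symBelow_le_iff (p := (symBelow 𝒱 n).comap (straighten ν - LinearMap.id))).2
    (fun k hk x hx => ?_) hx
  rw [Submodule.mem_comap, LinearMap.sub_apply, straighten_apply ν hx]
  exact symBelow_mono (by omega)
    (hν.binomialOperator_sub_mem (symPow_le_symBelow (by omega) hx))

theorem bijective_straighten (hν : IsIndexOperator (fun n : ℕ => symBelow 𝒱 n) ν) :
    Function.Bijective (straighten ν) :=
  bijective_of_sub_mem_filtration hν.zero exists_mem_symBelow
    fun n _ hx => straighten_sub_mem hν n hx

theorem map_straighten_tmul_sub_mem (hν : IsIndexOperator (fun n : ℕ => symBelow 𝒱 n) ν)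
    {i j : ℕ} {a b : SymCoalg 𝒱} (ha : a ∈ symPow 𝒱 i) (hb : b ∈ symPow 𝒱 j) :
    straighten ν a ⊗ₜ straighten ν b - a ⊗ₜ b ∈ tensorBelow 𝒱 (i + j : ℕ) := by
  have ha' : a ∈ symBelow 𝒱 (i + 1 : ℕ) := symPow_le_symBelow (by omega) ha
  have hb' : b ∈ symBelow 𝒱 (j + 1 : ℕ) := symPow_le_symBelow (by omega) hb
  have hb'' : straighten ν b ∈ symBelow 𝒱 (j + 1 : ℕ) := by
    simpa only [sub_add_cancel] using
      add_mem (symBelow_mono (by omega) (straighten_sub_mem hν j hb')) hb'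
  have hleft := tmul_mem_tensorBelow (k := (i + j : ℕ)) (straighten_sub_mem hν i ha') hb''
    (by push_cast; omega)
  have hright := tmul_mem_tensorBelow (k := (i + j : ℕ)) ha' (straighten_sub_mem hν j hb')
    (by push_cast; omega)
  simpa only [TensorProduct.sub_tmul, TensorProduct.tmul_sub, sub_add_sub_cancel] using
    add_mem hleft hright

theorem comul_straighten (hν : IsIndexOperator (fun n : ℕ => symBelow 𝒱 n) ν)
    (hνc : IsCoderivation 𝒱 0 ν) {n : ℕ} {x : SymCoalg 𝒱} (hx : x ∈ symPow 𝒱 n) :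
    comul 𝒱 (straighten ν x) = TensorProduct.map (straighten ν) (straighten ν) (comul 𝒱 x) := by
  refine (isIndexOperator_leibniz hν).eq_of_apply_eq_smul (n := n) ?_ ?_ ?_
  · rw [← hνc.comul_apply_eq_leibniz, apply_straighten hν hx, map_smul]
  · refine comul_mem_of_tmul_mem (N := LinearMap.eqLocus
      (leibniz ν ∘ₗ TensorProduct.map (straighten ν) (straighten ν))
      ((n : K) • TensorProduct.map (straighten ν) (straighten ν))) hx fun i j hij a ha b hb => ?_
    subst hij
    simp only [LinearMap.mem_eqLocus, LinearMap.comp_apply, LinearMap.smul_apply,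
      TensorProduct.map_tmul, leibniz_tmul, apply_straighten hν ha, apply_straighten hν hb,
      TensorProduct.tmul_smul, ← TensorProduct.smul_tmul']
    rw [Nat.cast_add, add_smul]
  · have hcomul : comul 𝒱 (straighten ν x) - comul 𝒱 x ∈ tensorBelow 𝒱 n := by
      rw [← map_sub]
      exact comul_mem_tensorBelow (straighten_sub_mem hν n (symPow_le_symBelow (by omega) hx))
    have hmap : TensorProduct.map (straighten ν) (straighten ν) (comul 𝒱 x) - comul 𝒱 x ∈
        tensorBelow 𝒱 n := by
      refine comul_mem_of_tmul_mem (N := (tensorBelow 𝒱 n).comap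
        (TensorProduct.map (straighten ν) (straighten ν) - LinearMap.id)) hx
        fun i j hij a ha b hb => ?_
      subst hij
      exact map_straighten_tmul_sub_mem hν ha hb
    simpa only [sub_sub_sub_cancel_right] using sub_mem hcomul hmap

theorem counit_straighten (hν : IsIndexOperator (fun n : ℕ => symBelow 𝒱 n) ν)
    (hνc : IsCoderivation 𝒱 0 ν) {n : ℕ} {x : SymCoalg 𝒱} (hx : x ∈ symPow 𝒱 n) :
    counit 𝒱 (straighten ν x) = counit 𝒱 x := by
  rcases eq_or_ne n 0 with rfl | hn
  · rw [straighten_apply ν hx, binomialOperator_zero, Module.End.one_apply]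
  · have h := congrArg (counit 𝒱) (apply_straighten hν hx)
    rw [hνc.counit_apply, map_smul, smul_eq_mul] at h
    rw [counit_of_mem_symPow hn hx]
    exact (mul_eq_zero.1 h.symm).resolve_left (Nat.cast_ne_zero.2 hn)

theorem isCoalgHom_straighten (hν : IsIndexOperator (fun n : ℕ => symBelow 𝒱 n) ν)
    (hνc : IsCoderivation 𝒱 0 ν) : IsCoalgHom 𝒱 𝒱 (straighten ν) where
  hasDegree := hasDegree_straighten hνc.hasDegree
  comul_comp := linearMap_ext_symPow fun _ _ hx => comul_straighten hν hνc hx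
  counit_comp := linearMap_ext_symPow fun _ _ hx => counit_straighten hν hνc hx
  map_one := by
    rw [straighten_apply ν (IsMonomial.one.mem_symPow 𝒱), binomialOperator_zero,
      Module.End.one_apply]

theorem IsCoderivation.isIndexOperator_hat_proj_add {β : SymCoalg 𝒱 →ₗ[K] SymCoalg 𝒱}
    (hβ : IsCoderivation 𝒱 0 β) (hβ2 : β ∈ vanishingBelow 𝒱 2) :
    IsIndexOperator (fun n : ℕ => symBelow 𝒱 n) (hat 𝒱 (proj 𝒱) + β) where
  zero := symBelow_zero
  mono _ _ h := symBelow_mono (Nat.cast_le.2 h)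
  sub_mem n x hx := by
    have hproj : hat 𝒱 (proj 𝒱) x - (n : K) • x ∈ symBelow 𝒱 n := by
      refine (symBelow_le_iff (p := (symBelow 𝒱 n).comap
        (hat 𝒱 (proj 𝒱) - (n : K) • LinearMap.id))).2 (fun k hk x hx => ?_) hx
      change hat 𝒱 (proj 𝒱) x - (n : K) • x ∈ symBelow 𝒱 n
      rw [hat_proj_symPow 𝒱 hx, ← sub_smul]
      obtain h | rfl : k < n ∨ k = n := by omega
      · exact Submodule.smul_mem _ _ (symPow_le_symBelow (by omega) hx)
      · rw [sub_self, zero_smul]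
        exact zero_mem _
    rw [LinearMap.add_apply, add_sub_right_comm]
    exact add_mem hproj (hβ.apply_mem_symBelow hβ2 hx (by omega))

end Straighten

end SymCoalg

namespace LInfinityOneAlgebra

section ToQuadraticPart

variable {𝒱 : ℤ → Submodule K V} [DirectSum.Decomposition 𝒱] {L : LInfinityOneAlgebra 𝒱}
  [CharZero K]

open SymCoalg

theorem quadraticPart_Q_mem_symPow (hL : L.IsMinimal) {n : ℕ} {x : SymCoalg 𝒱}
    (hx : x ∈ symPow 𝒱 (n + 1)) : (L.quadraticPart hL).Q x ∈ symPow 𝒱 n :=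
  hat_mem_symPow 𝒱 (k := 2) (fun _ hl _ hx => L.bracket_apply_ne hl hx) rfl hx

theorem Q_sub_quadraticPart_Q_mem (hL : L.IsMinimal) :
    L.Q - (L.quadraticPart hL).Q ∈ vanishingBelow 𝒱 3 := by
  refine (L.isCoderivation.sub 𝒱 (L.quadraticPart hL).isCoderivation).mem_vanishingBelow
    fun k hk x hx => ?_
  change proj 𝒱 (L.Q x - hat 𝒱 (L.bracket 2) x) = 0
  rw [map_sub, proj_hat_apply]
  obtain rfl | rfl | rfl : k = 0 ∨ k = 1 ∨ k = 2 := by omega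
  · rw [L.proj_Q_zero hx, L.bracket_apply_ne (by omega) hx, sub_zero]
  · rw [← L.bracket_apply hx, show L.bracket 1 = 0 from hL, L.bracket_apply_ne (by omega) hx,
      LinearMap.zero_apply, sub_zero]
  · rw [L.bracket_apply hx, sub_self]

theorem HasEulerCocycle.exists_isIndexOperator (h : L.HasEulerCocycle) :
    ∃ ν, IsIndexOperator (fun n : ℕ => symBelow 𝒱 n) ν ∧ IsCoderivation 𝒱 0 ν ∧
      ⁅ν, L.Q⁆ = -L.Q := by
  obtain ⟨z, hz, hze, hdz⟩ := h
  have hβ := hz.sub 𝒱 (isCoderivation_eulerDerivation 𝒱)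
  refine ⟨hat 𝒱 (proj 𝒱) + (z - eulerDerivation 𝒱), hβ.isIndexOperator_hat_proj_add hze,
    (isCoderivation_hat_proj 𝒱).add hβ, ?_⟩
  have hdeg : ⁅degreeDerivation 𝒱, L.Q⁆ = L.Q := by
    rw [L.isCoderivation.hasDegree.degreeDerivation_lie, Int.cast_one, one_smul]
  rw [CE_d_zero_apply] at hdz
  calc ⁅hat 𝒱 (proj 𝒱) + (z - eulerDerivation 𝒱), L.Q⁆
      = -⁅L.Q, z⁆ - ⁅degreeDerivation 𝒱, L.Q⁆ := by
        simp only [degreeDerivation, Ring.lie_def, add_mul, mul_add, sub_mul, mul_sub]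
        abel
    _ = -L.Q := by rw [hdz, hdeg, neg_zero, zero_sub]

theorem straighten_quadraticPart_Q (hL : L.IsMinimal) {ν : SymCoalg 𝒱 →ₗ[K] SymCoalg 𝒱}
    (hν : IsIndexOperator (fun n : ℕ => symBelow 𝒱 n) ν) (hνQ : ⁅ν, L.Q⁆ = -L.Q) {n : ℕ}
    {x : SymCoalg 𝒱} (hx : x ∈ symPow 𝒱 (n + 1)) :
    straighten ν ((L.quadraticPart hL).Q x) = L.Q (straighten ν x) := by
  have hQx := quadraticPart_Q_mem_symPow hL hx
  have hx' : x ∈ symBelow 𝒱 (n + 1 + 1 : ℕ) := symPow_le_symBelow (by omega) hx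
  refine hν.eq_of_apply_eq_smul (n := n) (apply_straighten hν hQx) ?_ ?_
  · have h := LinearMap.congr_fun hνQ (straighten ν x)
    rw [Ring.lie_def, LinearMap.sub_apply, Module.End.mul_apply, Module.End.mul_apply,
      apply_straighten hν hx, map_smul, LinearMap.neg_apply, sub_eq_iff_eq_add] at h
    rw [h]
    push_cast
    module
  · have hstr := straighten_sub_mem hν n (symPow_le_symBelow (by omega) hQx)
    have hQ := L.isCoderivation.apply_mem_symBelow (Q_mem_vanishingBelow_two hL)
      (straighten_sub_mem hν (n + 1) hx') (l := n) (by omega)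
    have hsub := (L.isCoderivation.sub 𝒱 (L.quadraticPart hL).isCoderivation).apply_mem_symBelow
      (Q_sub_quadraticPart_Q_mem hL) hx' (l := n) (by omega)
    rw [map_sub] at hQ
    rw [LinearMap.sub_apply] at hsub
    convert sub_mem (sub_mem hstr hQ) hsub using 1
    abel

theorem HasEulerCocycle.exists_isLInfinityIso (hL : L.IsMinimal) (h : L.HasEulerCocycle) :
    ∃ f, IsLInfinityIso (L.quadraticPart hL) L f := by
  obtain ⟨ν, hν, hνc, hνQ⟩ := h.exists_isIndexOperator
  refine ⟨straighten ν, ⟨isCoalgHom_straighten hν hνc, ?_⟩, bijective_straighten hν⟩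
  refine linearMap_ext_symPow fun n x hx => ?_
  cases n with
  | zero =>
    rw [eq_counit_smul_one 𝒱 hx, LinearMap.comp_apply, LinearMap.comp_apply, map_smul, map_smul,
      map_smul, map_smul, (isCoalgHom_straighten hν hνc).map_one, L.map_one,
      (L.quadraticPart hL).map_one, map_zero]
  | succ n => exact straighten_quadraticPart_Q hL hν hνQ hx

end ToQuadraticPart

end LInfinityOneAlgebra

namespace SymCoalg

section Primitive

variable {𝒱 : ℤ → Submodule K V} [DirectSum.Decomposition 𝒱]

theorem comul_ι (v : V) : comul 𝒱 (ι 𝒱 v) = ι 𝒱 v ⊗ₜ 1 + 1 ⊗ₜ ι 𝒱 v := by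
  induction v using DirectSum.Decomposition.inductionOn 𝒱 with
  | zero => simp only [map_zero, TensorProduct.zero_tmul, TensorProduct.tmul_zero, add_zero]
  | add v w hv hw =>
    rw [map_add, map_add, hv, hw, TensorProduct.add_tmul, TensorProduct.tmul_add,
      add_add_add_comm]
  | @homogeneous i v => simpa using comul_ι_mul 𝒱 v.2 1

theorem eq_ι_proj_of_comul_eq [CharZero K] {x : SymCoalg 𝒱}
    (hx : comul 𝒱 x = x ⊗ₜ 1 + 1 ⊗ₜ x) : x = ι 𝒱 (proj 𝒱 x) := by
  have hcounit : counit 𝒱 x = 0 := by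
    have h := congrArg ((TensorProduct.lid K K).toLinearMap ∘ₗ TensorProduct.map LinearMap.id
      (counit 𝒱).toLinearMap) (counit_comul_left 𝒱 x)
    simpa [hx] using h
  have hhat : ∀ y, comul 𝒱 y = y ⊗ₜ 1 + 1 ⊗ₜ y → hat 𝒱 (proj 𝒱) y = ι 𝒱 (proj 𝒱 y) :=
    fun y hy => by simp [hat, hy]
  refine sub_eq_zero.1 (eq_zero_of_hat_proj_eq_zero 𝒱 ?_ ?_)
  · rw [map_sub, hhat x hx, hhat _ (comul_ι _), proj_ι, sub_self]
  · rw [map_sub, hcounit, counit_ι, sub_self]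

theorem mem_vanishingBelow_two_iff {α : SymCoalg 𝒱 →ₗ[K] SymCoalg 𝒱} :
    α ∈ vanishingBelow 𝒱 2 ↔ α 1 = 0 ∧ ∀ i, ∀ v ∈ 𝒱 i, α (ι 𝒱 v) = 0 := by
  refine ⟨fun h => ⟨h 0 (by norm_num) 1 (IsMonomial.one.mem_symPow 𝒱),
    fun i v _ => h 1 (by norm_num) _ (ι_mem_symPow v)⟩, fun ⟨hone, hι⟩ k hk x hx => ?_⟩
  refine Submodule.span_le (p := LinearMap.ker α).2 ?_ hx
  rintro y ⟨n, d, hy, rfl⟩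
  cases hy with
  | one => exact hone
  | @ι_mul i n d v y hv hy =>
    obtain rfl : n = 0 := by change ((n + 1 : ℕ) : ℤ) < 2 at hk; omega
    cases hy
    rw [mul_one]
    exact hι i v hv

theorem sub_eulerDerivation_mem_vanishingBelow_two_iff {z : SymCoalg 𝒱 →ₗ[K] SymCoalg 𝒱} :
    z - eulerDerivation 𝒱 ∈ vanishingBelow 𝒱 2 ↔
      z 1 = 0 ∧ ∀ i, ∀ v ∈ 𝒱 i, z (ι 𝒱 v) = (i + 1 : K) • ι 𝒱 v := by
  have hone : eulerDerivation 𝒱 1 = 0 := by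
    simpa using (IsMonomial.one (𝒱 := 𝒱)).eulerDerivation_apply
  have hι : ∀ i, ∀ v ∈ 𝒱 i, eulerDerivation 𝒱 (ι 𝒱 v) = (i + 1 : K) • ι 𝒱 v := fun i v hv => by
    rw [(IsMonomial.ι 𝒱 hv).eulerDerivation_apply, Nat.cast_one, add_comm]
  rw [mem_vanishingBelow_two_iff, LinearMap.sub_apply, hone, sub_zero]
  refine and_congr_right' (forall₃_congr fun i v hv => ?_)
  rw [LinearMap.sub_apply, hι i v hv, sub_eq_zero]

end Primitive

section Homogeneous

variable {M N : Type*} [AddCommGroup M] [Module K M] [AddCommGroup N] [Module K N]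
  {ℳ : ℤ → Submodule K M} {𝒩 : ℤ → Submodule K N} [DirectSum.Decomposition ℳ]
  [DirectSum.Decomposition 𝒩]

theorem HasDegree.decompose_apply {f : M →ₗ[K] N} (hf : HasDegree ℳ 𝒩 0 f) (x : M) (i : ℤ) :
    (DirectSum.decompose 𝒩 (f x) i : N) = f (DirectSum.decompose ℳ x i) := by
  induction x using DirectSum.Decomposition.inductionOn ℳ with
  | zero => simp
  | add x y hx hy => simp [hx, hy, DirectSum.decompose_add]
  | @homogeneous j x =>
    have hfx := hf j x x.2
    rw [add_zero] at hfx
    obtain rfl | hj := eq_or_ne j i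
    · rw [DirectSum.decompose_of_mem_same _ hfx, DirectSum.decompose_of_mem_same _ x.2]
    · rw [DirectSum.decompose_of_mem_ne _ hfx hj, DirectSum.decompose_of_mem_ne _ x.2 hj, map_zero]

theorem HasDegree.symm {e : M ≃ₗ[K] N} (he : HasDegree ℳ 𝒩 0 e.toLinearMap) :
    HasDegree 𝒩 ℳ 0 e.symm.toLinearMap := by
  intro d y hy
  have h : e (DirectSum.decompose ℳ (e.symm y) d) = y := by
    have h := he.decompose_apply (e.symm y) d
    rwa [LinearEquiv.coe_coe, e.apply_symm_apply, DirectSum.decompose_of_mem_same _ hy,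
      eq_comm] at h
  rw [add_zero, LinearEquiv.coe_coe, ← e.eq_symm_apply.2 h]
  exact SetLike.coe_mem _

end Homogeneous

end SymCoalg

section CoalgHom

open SymCoalg

variable {W : Type*} [AddCommGroup W] [Module K W] {𝒱 : ℤ → Submodule K V}
  {𝒲 : ℤ → Submodule K W} [DirectSum.Decomposition 𝒱] [DirectSum.Decomposition 𝒲]

theorem SymCoalg.HasDegree.signMap_apply {f : SymCoalg 𝒱 →ₗ[K] SymCoalg 𝒲}
    (hf : HasDegree (degPart 𝒱) (degPart 𝒲) 0 f) (k : ℤ) (x : SymCoalg 𝒱) :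
    signMap 𝒲 k (f x) = f (signMap 𝒱 k x) := by
  induction x using DirectSum.Decomposition.inductionOn (degPart 𝒱) with
  | zero => simp only [map_zero]
  | add x y hx hy => simp only [map_add, hx, hy]
  | @homogeneous d x =>
    have hfx := hf d x x.2
    rw [add_zero] at hfx
    rw [SymCoalg.signMap_apply 𝒲 k hfx, SymCoalg.signMap_apply 𝒱 k x.2, map_smul]

namespace IsCoalgHom

theorem apply_ι [CharZero K] {f : SymCoalg 𝒱 →ₗ[K] SymCoalg 𝒲} (hf : IsCoalgHom 𝒱 𝒲 f) (v : V) :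
    f (ι 𝒱 v) = ι 𝒲 (proj 𝒲 (f (ι 𝒱 v))) := by
  refine eq_ι_proj_of_comul_eq ?_
  refine (LinearMap.congr_fun hf.comul_comp (ι 𝒱 v)).trans ?_
  rw [LinearMap.comp_apply, comul_ι, map_add, TensorProduct.map_tmul, TensorProduct.map_tmul,
    hf.map_one]

variable {e : SymCoalg 𝒱 ≃ₗ[K] SymCoalg 𝒲}

theorem symm (he : IsCoalgHom 𝒱 𝒲 e.toLinearMap) : IsCoalgHom 𝒲 𝒱 e.symm.toLinearMap where
  hasDegree := he.hasDegree.symm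
  comul_comp := by
    have hee : TensorProduct.map e.symm.toLinearMap e.symm.toLinearMap ∘ₗ
        TensorProduct.map e.toLinearMap e.toLinearMap = LinearMap.id := by
      rw [← TensorProduct.map_comp, LinearEquiv.symm_comp, TensorProduct.map_id]
    rw [LinearEquiv.comp_toLinearMap_symm_eq, LinearMap.comp_assoc, he.comul_comp,
      ← LinearMap.comp_assoc, hee, LinearMap.id_comp]
  counit_comp := by
    rw [LinearEquiv.comp_toLinearMap_symm_eq, he.counit_comp]
  map_one := e.symm_apply_eq.2 he.map_one.symm

theorem isCoderivation_conj (he : IsCoalgHom 𝒱 𝒲 e.toLinearMap) {n : ℤ}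
    {α : SymCoalg 𝒱 →ₗ[K] SymCoalg 𝒱} (hα : IsCoderivation 𝒱 n α) :
    IsCoderivation 𝒲 n (e.conj α) where
  hasDegree d y hy := by
    have h := he.hasDegree _ _ (hα.hasDegree _ _ (he.symm.hasDegree d y hy))
    rwa [add_zero, add_zero] at h
  comul_comp := by
    have hconj : e.conj α ∘ₗ e.toLinearMap = e.toLinearMap ∘ₗ α := by
      ext x
      simp [LinearEquiv.conj_apply]
    have hsign : signMap 𝒲 n ∘ₗ e.toLinearMap = e.toLinearMap ∘ₗ signMap 𝒱 n :=
      LinearMap.ext (he.hasDegree.signMap_apply n)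
    refine (LinearMap.cancel_right (g := e.toLinearMap) e.surjective).1 ?_
    calc (comul 𝒲 ∘ₗ e.conj α) ∘ₗ e.toLinearMap
        = TensorProduct.map e.toLinearMap e.toLinearMap ∘ₗ comul 𝒱 ∘ₗ α := by
          rw [LinearMap.comp_assoc, hconj, ← LinearMap.comp_assoc, he.comul_comp,
            LinearMap.comp_assoc]
      _ = (TensorProduct.map (e.conj α) LinearMap.id + TensorProduct.map (signMap 𝒲 n) (e.conj α))
          ∘ₗ TensorProduct.map e.toLinearMap e.toLinearMap ∘ₗ comul 𝒱 := by
          rw [hα.comul_comp, ← LinearMap.comp_assoc, ← LinearMap.comp_assoc]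
          congr 1
          simp only [LinearMap.comp_add, LinearMap.add_comp, ← TensorProduct.map_comp, hconj,
            hsign, LinearMap.id_comp, LinearMap.comp_id]
      _ = ((TensorProduct.map (e.conj α) LinearMap.id +
          TensorProduct.map (signMap 𝒲 n) (e.conj α)) ∘ₗ comul 𝒲) ∘ₗ e.toLinearMap := by
          rw [← he.comul_comp, LinearMap.comp_assoc]

end IsCoalgHom

end CoalgHom

namespace LInfinityOneAlgebra

section FromQuadraticPart

variable {W : Type*} [AddCommGroup W] [Module K W] {𝒱 : ℤ → Submodule K V}
  {𝒲 : ℤ → Submodule K W} [DirectSum.Decomposition 𝒱] [DirectSum.Decomposition 𝒲]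
  {L : LInfinityOneAlgebra 𝒱} {M : LInfinityOneAlgebra 𝒲} [CharZero K]

open SymCoalg

theorem HasEulerCocycle.of_isLInfinityIso (h : L.HasEulerCocycle)
    {f : SymCoalg 𝒱 →ₗ[K] SymCoalg 𝒲} (hf : IsLInfinityIso L M f) : M.HasEulerCocycle := by
  obtain ⟨z, hz, hze, hdz⟩ := h
  obtain ⟨⟨hf, hfQ⟩, hbij⟩ := hf
  obtain ⟨e, rfl⟩ : ∃ e : SymCoalg 𝒱 ≃ₗ[K] SymCoalg 𝒲, e.toLinearMap = f :=
    ⟨LinearEquiv.ofBijective f hbij, rfl⟩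
  obtain ⟨hz1, hzι⟩ := sub_eulerDerivation_mem_vanishingBelow_two_iff.1 hze
  refine ⟨e.conj z, hf.isCoderivation_conj hz,
    sub_eulerDerivation_mem_vanishingBelow_two_iff.2 ⟨?_, fun i w hw => ?_⟩, ?_⟩
  · rw [LinearEquiv.conj_apply_apply, show e.symm 1 = 1 from hf.symm.map_one, hz1, map_zero]
  · have hmem : proj 𝒱 (e.symm (ι 𝒲 w)) ∈ 𝒱 i := by
      have h := hf.symm.hasDegree i _ (ι_mem_degPart 𝒲 hw)
      rw [add_zero] at h
      exact proj_mem 𝒱 h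
    have hι : e.symm (ι 𝒲 w) = ι 𝒱 (proj 𝒱 (e.symm (ι 𝒲 w))) := hf.symm.apply_ι w
    rw [LinearEquiv.conj_apply_apply, hι, hzι i _ hmem, map_smul, ← hι, e.apply_symm_apply]
  · have hMQ : M.Q = e.conj L.Q := by
      rw [LinearEquiv.conj_apply, hfQ, LinearMap.comp_assoc, LinearEquiv.comp_symm,
        LinearMap.comp_id]
    rw [CE_d_zero_apply] at hdz ⊢
    calc ⁅M.Q, e.conj z⁆ = e.conj ⁅L.Q, z⁆ := by
          rw [hMQ, Ring.lie_def, Ring.lie_def, map_sub]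
          exact congrArg₂ _ (e.conj_comp _ _).symm (e.conj_comp _ _).symm
      _ = 0 := by rw [hdz, map_zero]

theorem hat_proj_lie_quadraticPart_Q (hL : L.IsMinimal) :
    ⁅hat 𝒱 (proj 𝒱), (L.quadraticPart hL).Q⁆ = -(L.quadraticPart hL).Q := by
  refine linearMap_ext_symPow fun n x hx => ?_
  rw [Ring.lie_def, LinearMap.sub_apply, Module.End.mul_apply, Module.End.mul_apply,
    hat_proj_symPow 𝒱 hx, map_smul, LinearMap.neg_apply]
  cases n with
  | zero =>
    rw [eq_counit_smul_one 𝒱 hx, map_smul, (L.quadraticPart hL).map_one]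
    simp
  | succ n =>
    rw [hat_proj_symPow 𝒱 (quadraticPart_Q_mem_symPow hL hx)]
    push_cast
    module

theorem hasEulerCocycle_quadraticPart (hL : L.IsMinimal) :
    (L.quadraticPart hL).HasEulerCocycle := by
  refine ⟨eulerDerivation 𝒱, isCoderivation_eulerDerivation 𝒱, by simp, ?_⟩
  have hdeg : ⁅degreeDerivation 𝒱, (L.quadraticPart hL).Q⁆ = (L.quadraticPart hL).Q := by
    rw [(L.quadraticPart hL).isCoderivation.hasDegree.degreeDerivation_lie, Int.cast_one, one_smul]
  rw [CE_d_zero_apply]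
  calc ⁅(L.quadraticPart hL).Q, eulerDerivation 𝒱⁆
      = -(⁅degreeDerivation 𝒱, (L.quadraticPart hL).Q⁆ +
          ⁅hat 𝒱 (proj 𝒱), (L.quadraticPart hL).Q⁆) := by
        simp only [degreeDerivation, Ring.lie_def, sub_mul, mul_sub]
        abel
    _ = 0 := by rw [hdeg, hat_proj_lie_quadraticPart_Q hL, add_neg_cancel, neg_zero]

end FromQuadraticPart

end LInfinityOneAlgebra

end

end LInfinity

theorem theorem6p3 {K V : Type*} [Field K] [CharZero K] [AddCommGroup V] [Module K V]
    (𝒱 : ℤ → Submodule K V) [DirectSum.Decomposition 𝒱]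
    (L : LInfinity.LInfinityOneAlgebra 𝒱) (hL : L.IsMinimal) :
    List.TFAE [
      ∃ f : LInfinity.SymCoalg 𝒱 →ₗ[K] LInfinity.SymCoalg 𝒱,
        LInfinity.IsLInfinityIso (L.quadraticPart hL) L f,
      L.CE.DegeneratesAt 2,
      L.CE.AllDifferentialsVanish (L.eulerClass hL)] := by
  tfae_have 1 → 2 := fun ⟨_, hf⟩ =>
    (LInfinity.LInfinityOneAlgebra.hasEulerCocycle_quadraticPart hL
      |>.of_isLInfinityIso hf).degeneratesAt_two
  tfae_have 2 → 3 := fun h => h.allDifferentialsVanish _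
  tfae_have 3 → 1 := fun h =>
    (LInfinity.LInfinityOneAlgebra.hasEulerCocycle_of_allDifferentialsVanish hL h
      ).exists_isLInfinityIso hL
  tfae_finish
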